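/- Let $d\ge 2$ be an integer, $\mathbb{T}^d=(\mathbb{R}/2\pi\mathbb{Z})^d$, and write each $\mathbb{R}^d$-valued distribution on $\mathbb{T}^d$ as $v=\sum_{k\in\mathbb{Z}^d}v_k e_k$ with $e_k(x)=(2\pi)^{-d/2}e^{ik\cdot x}$. For $p\in\mathbb{R}$ let $\mathbb{H}^p$ be the space of those $v$ with $\operatorname{div}v=0$, zero mean and $\|v\|_p^2:=\sum_{k\ne0}|k|^{2p}|v_k|^2<\infty$, with inner product $\langle v|w\rangle_p=\sum_{k\ne 0}|k|^{2p}\,\overline{v_k}\cdot w_k$. Let $\mathbf{H}^p=\mathbb{H}^p\times\mathbb{H}^p$ with $\langle(v,b)|(w,c)\rangle_p=\langle v|w\rangle_p+\langle b|c\rangle_p$ and the corresponding norm $\|\cdot\|_p$, and let $\mathbf{H}^\infty=\bigcap_{p\in\mathbb{R}}\mathbf{H}^p$, a Fréchet space with the norms $\|\cdot\|_p$. Let $\mathcal{L}$ be the Leray projection, $\mathscr{P}(v,w)=-\mathcal{L}(v\cdot\partial w)$, where $(v\cdot\partial w)_r=\sum_s v_s\partial_s w_r$, and $$\boldsymbol{\mathscr{P}}\big((v,b),(w,c)\big)=\big(\mathscr{P}(v,w)-\mathscr{P}(b,c),\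 \mathscr{P}(v,c)-\mathscr{P}(b,w)\big).$$ For $\nu,\eta\in[0,+\infty)$ let $\boldsymbol{\mathscr{A}}(v,b)=(\nu\Delta v,\eta\Delta b)$ and $\mu=\min(\nu,\eta)$. Let $n,p\in\mathbb{R}$ with $d/2+1<n\le p$. Then $\boldsymbol{\mathscr{P}}$ maps $\mathbf{H}^p\times\mathbf{H}^{p+1}$ into $\mathbf{H}^p$, and there are constants $\hat K_p,\hat G_p,\hat G_{pn}\in(0,+\infty)$ such that, for all $\mathbf{v}\in\mathbf{H}^p$ and $\mathbf{w}\in\mathbf{H}^{p+1}$, $$\|\boldsymbol{\mathscr{P}}(\mathbf{v},\mathbf{w})\|_p\le\hat K_p\|\mathbf{v}\|_p\|\mathbf{w}\|_{p+1},\qquad |\langle\boldsymbol{\mathscr{P}}(\mathbf{v},\mathbf{w})|\mathbf{w}\rangle_p|\le\hat G_p\|\mathbf{v}\|_p\|\mathbf{w}\|_p^2,$$ $$|\langle\boldsymbol{\mathscr{P}}(\mathbf{v},\mathbf{w})|\mathbf{w}\rangle_p|\le\tfrac12\hat G_{pn}\big(\|\mathbf{v}\|_p\|\mathbf{w}\|_n+\|\mathbf{v}\|_n\|\mathbf{w}\|_p\big)\|\mathbf{w}\|_p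 .$$ Moreover, for any positive constants $\hat K_p,\hat G_p,\hat G_{pn}$ with these properties the following holds. Let $\nu,\eta\ge0$, $\mathbf{u}_0\in\mathbf{H}^\infty$, let $T,T_a\in(0,+\infty]$, let $\mathbf{u}\in C^\infty([0,T),\mathbf{H}^\infty)$ be a solution (for instance the maximal one) of the MHD Cauchy problem $$\dot{\mathbf{u}}=\boldsymbol{\mathscr{A}}\mathbf{u}+\boldsymbol{\mathscr{P}}(\mathbf{u},\mathbf{u}),\qquad\mathbf{u}(0)=\mathbf{u}_0,$$ and let $\mathbf{u}_a\in C^1([0,T_a),\mathbf{H}^\infty)$ (an approximate solution), with differential error $\mathbf{e}=\frac{d\mathbf{u}_a}{dt}-\boldsymbol{\mathscr{A}}\mathbf{u}_a-\boldsymbol{\mathscr{P}}(\mathbf{u}_a,\mathbf{u}_a)$. (i) For every $q\in\mathbb{R}$ the function $t\mapsto\|\mathbf{u}(t)-\mathbf{u}_a(t)\|_q$ is continuous on $[0,\min(T,T_a))$, and it is differentiable (from the right, if $t=0$) at each $t$ in this interval with $\mathbf{u}(t)\ne\mathbf{u}_a(t)$. (ii) Let $\epsilon_p,\mathcal{D}_p,\mathcal{D}_{p+1}:[0,T_a)\to[0,+\infty)$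 be continuous functions such that $\|\mathbf{e}(t)\|_p\le\epsilon_p(t)$, $\|\mathbf{u}_a(t)\|_p\le\mathcal{D}_p(t)$ and $\|\mathbf{u}_a(t)\|_{p+1}\le\mathcal{D}_{p+1}(t)$ for all $t\in[0,T_a)$. Then everywhere on $[0,\min(T,T_a))$ $$\frac{d^+}{dt}\|\mathbf{u}-\mathbf{u}_a\|_p\le-\mu\|\mathbf{u}-\mathbf{u}_a\|_p+(\hat G_p\mathcal{D}_p+\hat K_p\mathcal{D}_{p+1})\|\mathbf{u}-\mathbf{u}_a\|_p+\hat G_{pn}\|\mathbf{u}-\mathbf{u}_a\|_n\|\mathbf{u}-\mathbf{u}_a\|_p+\epsilon_p,$$ where $\frac{d^+f}{dt}(t)=\limsup_{h\to0^+}\frac{f(t+h)-f(t)}{h}\in[-\infty,+\infty]$ is the right, upper Dini derivative. -/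

import Mathlib

open Filter Topology

noncomputable section

namespace MHD

/-! ## Vector fields on the torus `(ℝ / 2πℤ)^d`

A (vector valued, distributional) field is represented by its Fourier coefficients
`v_k ∈ ℂ^d`, `k ∈ ℤ^d`, relative to `e_k(x) = (2π)^{-d/2} exp (i k • x)`. -/

/-- Families of coefficients `k ↦ v_k ∈ ℂ^d`, for `k ∈ ℤ^d`. -/
abbrev Coeffs (d : ℕ) : Type := (Fin d → ℤ) → EuclideanSpace ℂ (Fin d)

/-- The Euclidean length `|k|` of a lattice point. -/
def latNorm {d : ℕ} (k : Fin d → ℤ) : ℝ := Real.sqrt (∑ i, (k i : ℝ) ^ 2)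

/-- The bilinear product `k • c = ∑_r k_r c_r`. -/
def latDot {d : ℕ} (k : Fin d → ℤ) (c : EuclideanSpace ℂ (Fin d)) : ℂ :=
  ∑ r, (k r : ℂ) * c r

/-- `v` is the family of Fourier coefficients of an `ℝ^d`-valued distribution on the torus:
it is of at most polynomial growth and `v_{-k}` is the complex conjugate of `v_k`. -/
def IsDistribution {d : ℕ} (v : Coeffs d) : Prop :=
  (∀ k r, v (-k) r = (starRingEnd ℂ) (v k r)) ∧
    ∃ (C : ℝ) (N : ℕ), ∀ k, ‖v k‖ ≤ C * (1 + latNorm k) ^ N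

/-- The Sobolev space of order `p` of divergence free, zero mean vector fields on the torus. -/
def HM (d : ℕ) (p : ℝ) : Set (Coeffs d) :=
  {v | IsDistribution v ∧ (∀ k, latDot k (v k) = 0) ∧ v 0 = 0 ∧
    Summable fun k : {k : Fin d → ℤ // k ≠ 0} => latNorm k.1 ^ (2 * p) * ‖v k.1‖ ^ 2}

/-- `⟨v | w⟩_p = ∑_{k ≠ 0} |k|^{2p} (conj v_k) • w_k` (a real number for real fields). -/
def hinner {d : ℕ} (p : ℝ) (v w : Coeffs d) : ℝ :=
  ∑' k : {k : Fin d → ℤ // k ≠ 0}, latNorm k.1 ^ (2 * p) * (inner ℂ (v k.1) (w k.1)).re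

/-- `‖v‖_p = √⟨v | v⟩_p`. -/
def hnorm {d : ℕ} (p : ℝ) (v : Coeffs d) : ℝ := Real.sqrt (hinner p v v)

/-! ## The operators -/

/-- The Laplacian: `(Δ v)_k = -|k|² v_k`. -/
def laplacian {d : ℕ} (v : Coeffs d) : Coeffs d :=
  fun k => ((-(latNorm k ^ 2) : ℝ) : ℂ) • v k

/-- The Leray projection: for each `k`, the orthogonal projection
`c ↦ c - (k • c) k / |k|²` of `ℂ^d` onto `k^⊥` (the identity for `k = 0`). -/
def leray {d : ℕ} (v : Coeffs d) : Coeffs d :=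
  fun k => WithLp.toLp 2 fun r =>
    v k r - latDot k (v k) * (k r : ℂ) / ((latNorm k ^ 2 : ℝ) : ℂ)

/-- The Fourier coefficients `i k_s f_k` of the partial derivative `∂_s f` of a scalar
distribution `f`. -/
def partialDeriv {d : ℕ} (s : Fin d) (f : (Fin d → ℤ) → ℂ) : (Fin d → ℤ) → ℂ :=
  fun k => Complex.I * (k s : ℂ) * f k

/-- The Fourier coefficients `(2π)^{-d/2} ∑_h f_h g_{k-h}` of the product of `f` and `g`
(see `synth_mulCoeffs`). -/
def mulCoeffs {d : ℕ} (f g : (Fin d → ℤ) → ℂ) : (Fin d → ℤ) → ℂ :=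
  fun k => (((2 * Real.pi) ^ (-(d : ℝ) / 2) : ℝ) : ℂ) * ∑' h, f h * g (k - h)

/-- The vector field `v • ∂w`, with components `∑_s v_s ∂_s w_r`. -/
def advect {d : ℕ} (v w : Coeffs d) : Coeffs d :=
  fun k => WithLp.toLp 2 fun r =>
    ∑ s, mulCoeffs (fun h => v h s) (partialDeriv s fun h => w h r) k

/-- The fundamental bilinear map `P(v, w) = -L (v • ∂w)`. -/
def bilin {d : ℕ} (v w : Coeffs d) : Coeffs d := -leray (advect v w)

/-- The function `e_k(x) = (2π)^{-d/2} exp (i k • x)`. -/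
def expo {d : ℕ} (k : Fin d → ℤ) (x : Fin d → ℝ) : ℂ :=
  (((2 * Real.pi) ^ (-(d : ℝ) / 2) : ℝ) : ℂ) * Complex.exp (Complex.I * ∑ i, (k i : ℂ) * (x i : ℂ))

/-- The function with Fourier coefficients `f`. -/
def synth {d : ℕ} (f : (Fin d → ℤ) → ℂ) (x : Fin d → ℝ) : ℂ := ∑' k, f k * expo k x

theorem norm_expo {d : ℕ} (k : Fin d → ℤ) (x : Fin d → ℝ) :
    ‖expo k x‖ = (2 * Real.pi) ^ (-(d : ℝ) / 2) := by
  have h : Complex.I * ∑ i, (k i : ℂ) * (x i : ℂ)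
      = ((∑ i, (k i : ℝ) * x i : ℝ) : ℂ) * Complex.I := by
    push_cast; ring
  have h0 : (0 : ℝ) ≤ (2 * Real.pi) ^ (-(d : ℝ) / 2) := by positivity
  rw [expo, h, norm_mul, Complex.norm_exp_ofReal_mul_I, mul_one, Complex.norm_real,
    Real.norm_of_nonneg h0]

theorem expo_mul {d : ℕ} (h l : Fin d → ℤ) (x : Fin d → ℝ) :
    expo h x * expo l x = (((2 * Real.pi) ^ (-(d : ℝ) / 2) : ℝ) : ℂ) * expo (h + l) x := by
  have : Complex.I * ∑ i, (((h + l) i : ℤ) : ℂ) * (x i : ℂ)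
      = Complex.I * ∑ i, (h i : ℂ) * (x i : ℂ) + Complex.I * ∑ i, (l i : ℂ) * (x i : ℂ) := by
    rw [← mul_add, ← Finset.sum_add_distrib]
    congr 1
    refine Finset.sum_congr rfl fun i _ => ?_
    simp only [Pi.add_apply]; push_cast; ring
  simp only [expo]
  rw [this, Complex.exp_add]
  ring

/-- `mulCoeffs` computes the Fourier coefficients of the pointwise product of functions. -/
theorem synth_mulCoeffs {d : ℕ} {f g : (Fin d → ℤ) → ℂ}
    (hf : Summable fun k => ‖f k‖) (hg : Summable fun k => ‖g k‖) (x : Fin d → ℝ) :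
    synth (mulCoeffs f g) x = synth f x * synth g x := by
  have hf' : Summable fun k => ‖f k * expo k x‖ := by
    simp only [norm_mul, norm_expo]; exact hf.mul_right _
  have hg' : Summable fun k => ‖g k * expo k x‖ := by
    simp only [norm_mul, norm_expo]; exact hg.mul_right _
  let e : (Fin d → ℤ) × (Fin d → ℤ) ≃ (Fin d → ℤ) × (Fin d → ℤ) :=
    { toFun := fun a => (a.2, a.1 - a.2)
      invFun := fun b => (b.1 + b.2, b.1)
      left_inv := fun a => by simp
      right_inv := fun b => by simp }
  have hs := summable_mul_of_summable_norm hf' hg'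
  have hs' := (e.summable_iff).2 hs
  have key : synth f x * synth g x
      = ∑' k, ∑' h, (f h * expo h x) * (g (k - h) * expo (k - h) x) := by
    rw [synth, synth, tsum_mul_tsum_of_summable_norm hf' hg', ← e.tsum_eq]
    exact hs'.tsum_prod
  rw [key, synth]
  refine tsum_congr fun k => ?_
  rw [mulCoeffs, mul_right_comm, ← tsum_mul_left]
  refine tsum_congr fun h => ?_
  have := expo_mul h (k - h) x
  rw [add_sub_cancel] at this
  rw [mul_mul_mul_comm (f h), this]
  ring

/-! ## Pairs of fields (velocity, magnetic field) -/

/-- Pairs `(v, b)` of fields. -/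
abbrev Pair (d : ℕ) : Type := Coeffs d × Coeffs d

/-- The product of two copies of the Sobolev space of order `p`. -/
def HD (d : ℕ) (p : ℝ) : Set (Pair d) := {v | v.1 ∈ HM d p ∧ v.2 ∈ HM d p}

/-- The infinite order Sobolev space of pairs. -/
def HDinf (d : ℕ) : Set (Pair d) := {v | ∀ p : ℝ, v ∈ HD d p}

/-- `⟨(v, b) | (w, c)⟩_p = ⟨v | w⟩_p + ⟨b | c⟩_p`. -/
def pinner {d : ℕ} (p : ℝ) (v w : Pair d) : ℝ := hinner p v.1 w.1 + hinner p v.2 w.2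

/-- `‖v‖_p = √⟨v | v⟩_p`. -/
def pnorm {d : ℕ} (p : ℝ) (v : Pair d) : ℝ := Real.sqrt (pinner p v v)

/-- The operator `A (v, b) = (ν Δ v, η Δ b)`. -/
def mhdLin {d : ℕ} (ν η : ℝ) (v : Pair d) : Pair d := (ν • laplacian v.1, η • laplacian v.2)

/-- The bilinear map `((v, b), (w, c)) ↦ (P(v,w) - P(b,c), P(v,c) - P(b,w))`. -/
def mhdBilin {d : ℕ} (v w : Pair d) : Pair d :=
  (bilin v.1 w.1 - bilin v.2 w.2, bilin v.1 w.2 - bilin v.2 w.1)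

/-- `K > 0` is an admissible constant in the tame basic inequality of orders `p, n`. -/
def IsBasicConstant (d : ℕ) (p n K : ℝ) : Prop :=
  0 < K ∧ ∀ v ∈ HD d p, ∀ w ∈ HD d (p + 1),
    pnorm p (mhdBilin v w)
      ≤ 1 / 2 * K * (pnorm p v * pnorm (n + 1) w + pnorm n v * pnorm (p + 1) w)

/-- `G > 0` is an admissible constant in the tame Kato inequality of orders `p, n`. -/
def IsKatoConstant (d : ℕ) (p n G : ℝ) : Prop :=
  0 < G ∧ ∀ v ∈ HD d p, ∀ w ∈ HD d (p + 1),
    |pinner p (mhdBilin v w) w|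
      ≤ 1 / 2 * G * (pnorm p v * pnorm n w + pnorm n v * pnorm p w) * pnorm p w

/-! ## Curves in the infinite order Sobolev space

The Fréchet topology of `HDinf d` is the one of the norms `pnorm p`, `p ∈ ℝ`. -/

/-- The interval `[0, τ)`, with `τ ≤ +∞`. -/
def timeInterval (τ : EReal) : Set ℝ := {t | 0 ≤ t ∧ (t : EReal) < τ}

/-- `u : [0, τ) → HDinf d` is continuous. -/
def IsContCurve {d : ℕ} (τ : EReal) (u : ℝ → Pair d) : Prop :=
  (∀ t ∈ timeInterval τ, u t ∈ HDinf d) ∧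
    ∀ t ∈ timeInterval τ, ∀ p : ℝ,
      Tendsto (fun s => pnorm p (u s - u t)) (𝓝[timeInterval τ] t) (𝓝 0)

/-- The function `u : [0, τ) → HDinf d` has derivative `z ∈ HDinf d` at the instant `t`. -/
def HasTimeDeriv {d : ℕ} (τ : EReal) (u : ℝ → Pair d) (z : Pair d) (t : ℝ) : Prop :=
  z ∈ HDinf d ∧ ∀ p : ℝ,
    Tendsto (fun s => pnorm p ((s - t)⁻¹ • (u s - u t) - z)) (𝓝[timeInterval τ \ {t}] t) (𝓝 0)

/-- `u ∈ C^1([0, τ), HDinf d)`, with derivative `u'`. -/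
def IsC1Curve {d : ℕ} (τ : EReal) (u u' : ℝ → Pair d) : Prop :=
  IsContCurve τ u ∧ IsContCurve τ u' ∧ ∀ t ∈ timeInterval τ, HasTimeDeriv τ u (u' t) t

/-- `u ∈ C^∞([0, τ), HDinf d)`; `D j` is the derivative of order `j`. -/
def IsSmoothCurve {d : ℕ} (τ : EReal) (u : ℝ → Pair d) : Prop :=
  ∃ D : ℕ → ℝ → Pair d, D 0 = u ∧ ∀ j, IsC1Curve τ (D j) (D (j + 1))

/-- `u` is a solution of domain `[0, T)` of the MHD Cauchy problem
`u' = A u + P(u, u)`, `u(0) = u₀`. -/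
def IsSolution {d : ℕ} (ν η : ℝ) (u₀ : Pair d) (T : EReal) (u : ℝ → Pair d) : Prop :=
  IsSmoothCurve T u ∧
    (∀ t ∈ timeInterval T, HasTimeDeriv T u (mhdLin ν η (u t) + mhdBilin (u t) (u t)) t) ∧
    u 0 = u₀

/-- The differential error `u_a' - A u_a - P(u_a, u_a)`. -/
def diffError {d : ℕ} (ν η : ℝ) (ua ua' : ℝ → Pair d) (t : ℝ) : Pair d :=
  ua' t - mhdLin ν η (ua t) - mhdBilin (ua t) (ua t)

/-- `g ∈ C([0, τ), [0, +∞))` is an upper bound for `‖z(t)‖_p` on `[0, τ)`. For `z` the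
approximate solution this is a growth estimator, for `z` the differential error
a differential error estimator, of order `p`. -/
def IsEstimator {d : ℕ} (τ : EReal) (p : ℝ) (z : ℝ → Pair d) (g : ℝ → ℝ) : Prop :=
  ContinuousOn g (timeInterval τ) ∧
    ∀ t ∈ timeInterval τ, 0 ≤ g t ∧ pnorm p (z t) ≤ g t

/-- The right, upper Dini derivative of `f` at `t`, with values in `[-∞, +∞]`. -/
def dini (f : ℝ → ℝ) (t : ℝ) : EReal :=
  limsup (fun h : ℝ => (((f (t + h) - f t) / h : ℝ) : EReal)) (𝓝[>] 0)

end MHD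

end

/-!
The proof works with Fourier coefficients throughout; `wt p v k = |k|^p ‖v_k‖`, so that `‖v‖_p` is
the `ℓ²` norm of `wt p v`, and for `n > d / 2 + 1` the family `|k| ‖v_k‖` is summable with sum at
most a multiple of `‖v‖_n` (`HM.summable_one`).

*Boundedness of the bilinear map.* The coefficient `P(v, w)_k` is dominated by the convolution of
`‖v_h‖` and `|l| ‖w_l‖`, `k = h + l`. As `|k|^p ≤ 2^p (|h|^p + |l|^p)`, Young's inequality
`ℓ² * ℓ¹ ⊆ ℓ²` (`sq_conv_le`) gives `hnorm_bilin_le`.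

*The Kato inequality.* Put `T(v, w, z) = ⟨P(v, w) | z⟩_p`. As `v` is real and divergence free,
interchanging the modes of `w` and `z` shows that, up to a constant factor,
`T(v, w, z) + T(v, z, w)` is the sum over `k = h + l` of `(|k|^{2p} - |l|^{2p}) Re ⟨i (k • v_h) w_l, z_k⟩`, where also
`k • v_h = l • v_h`. The weight `| |k|^{2p} - |l|^{2p} | min(|k|, |l|)` is at most a multiple of
`|k|^p |l|^p |h| + |k|^p |h|^p |l| + |l|^p |h|^p |k|` (`kato_weight`), and each of the three
resulting trilinear sums is bounded by two `ℓ²` norms of order `p` and one `ℓ¹` norm of a first derivative.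
This is `kato_symm`. For pairs `(v, b)` and `(w, c)` the expression to be estimated is
`½ (T(v,w,w) + T(v,w,w)) + ½ (T(v,c,c) + T(v,c,c)) - (T(b,c,w) + T(b,w,c))`, a combination of
symmetrized forms only (`exists_katoConstant`).

*The differential inequality.* `emb q` embeds the Sobolev space of order `q` isometrically into a
Hilbert space, where the curve `δ = u - u_a` is differentiable. Where `δ ≠ 0`, its norm has the
right derivative `⟨δ' | δ⟩_p / ‖δ‖_p`, and with
`δ' = A δ + P(u_a, δ) + P(δ, u_a) + P(δ, δ) - e` the estimate is a sum of five bounds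
(`pinner_error_le`): dissipation, the Kato inequalities for `P(u_a, δ)` and `P(δ, δ)`, the basic
inequality for `P(δ, u_a)`, and Cauchy–Schwarz for `e`. Where `δ = 0`, `δ' = -e` and the right
derivative of the norm is `‖e‖_p`.
-/

noncomputable section

namespace MHD

/-! ### The lattice -/

/-- The lattice point `k` as a vector of Euclidean space. -/
def latVec {d : ℕ} (k : Fin d → ℤ) : EuclideanSpace ℝ (Fin d) := WithLp.toLp 2 fun i => (k i : ℝ)

theorem latNorm_eq_norm {d : ℕ} (k : Fin d → ℤ) : latNorm k = ‖latVec k‖ := by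
  simp [latNorm, latVec, EuclideanSpace.norm_eq]

theorem latNorm_nonneg {d : ℕ} (k : Fin d → ℤ) : 0 ≤ latNorm k := Real.sqrt_nonneg _

theorem latNorm_neg {d : ℕ} (k : Fin d → ℤ) : latNorm (-k) = latNorm k := by
  simp [latNorm]

@[simp]
theorem latNorm_zero {d : ℕ} : latNorm (0 : Fin d → ℤ) = 0 := by
  simp [latNorm]

theorem latNorm_add_le {d : ℕ} (h l : Fin d → ℤ) : latNorm (h + l) ≤ latNorm h + latNorm l := by
  simp only [latNorm_eq_norm]
  have : latVec (h + l) = latVec h + latVec l := by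
    ext i; simp [latVec]
  rw [this]
  exact norm_add_le _ _

theorem latNorm_sq {d : ℕ} (k : Fin d → ℤ) : latNorm k ^ 2 = ∑ i, (k i : ℝ) ^ 2 :=
  Real.sq_sqrt (Finset.sum_nonneg fun _ _ => sq_nonneg _)

theorem one_le_latNorm {d : ℕ} {k : Fin d → ℤ} (hk : k ≠ 0) : 1 ≤ latNorm k := by
  obtain ⟨i, hi⟩ : ∃ i, k i ≠ 0 := by
    by_contra! h
    exact hk (funext h)
  have h1 : (1 : ℝ) ≤ (k i : ℝ) ^ 2 := by
    have : (1 : ℤ) ≤ (k i) ^ 2 := by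
      have := sq_nonneg (k i)
      have h2 : (k i) ^ 2 ≠ 0 := pow_ne_zero _ hi
      omega
    exact_mod_cast this
  rw [latNorm, Real.one_le_sqrt]
  exact h1.trans (Finset.single_le_sum (f := fun i => (k i : ℝ) ^ 2)
    (fun _ _ => sq_nonneg _) (Finset.mem_univ i))

theorem latNorm_pos {d : ℕ} {k : Fin d → ℤ} (hk : k ≠ 0) : 0 < latNorm k :=
  zero_lt_one.trans_le (one_le_latNorm hk)

theorem summable_latNorm_rpow {d : ℕ} {r : ℝ} (hr : r < -(d : ℝ)) :
    Summable fun k : Fin d → ℤ => latNorm k ^ r := by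
  let b := (EuclideanSpace.basisFun (Fin d) ℝ).toBasis
  let L := Submodule.span ℤ (Set.range b)
  let e := (b.restrictScalars ℤ).equivFun
  have hfr : Module.finrank ℤ L = d := by
    rw [Module.finrank_eq_card_basis (b.restrictScalars ℤ), Fintype.card_fin]
  have hs := ZLattice.summable_norm_rpow L r (by rw [hfr]; exact hr)
  have hs' := (e.symm.toEquiv.summable_iff).2 hs
  refine hs'.congr fun k => ?_
  have : ((e.symm k : L) : EuclideanSpace ℝ (Fin d)) = latVec k := by
    rw [Module.Basis.equivFun_symm_apply, ← Submodule.subtype_apply, map_sum]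
    simp_rw [map_smul, Submodule.subtype_apply, Module.Basis.restrictScalars_apply]
    ext i
    simp [latVec, b, Pi.single_apply]
  simp only [Function.comp]
  rw [latNorm_eq_norm, ← this]
  rfl

/-! ### Sums over the lattice -/

theorem summable_mul_of_sq {ι : Type*} {f g : ι → ℝ}
    (hf2 : Summable fun i => f i ^ 2) (hg2 : Summable fun i => g i ^ 2) :
    Summable fun i => f i * g i := by
  refine Summable.of_norm_bounded (hf2.add hg2) fun i => ?_
  rw [Real.norm_eq_abs, abs_le]
  constructor <;> nlinarith [sq_nonneg (f i + g i), sq_nonneg (f i - g i), sq_nonneg (f i),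
    sq_nonneg (g i)]

theorem tsum_mul_le_sqrt {ι : Type*} {f g : ι → ℝ} (hf : ∀ i, 0 ≤ f i) (hg : ∀ i, 0 ≤ g i)
    (hf2 : Summable fun i => f i ^ 2) (hg2 : Summable fun i => g i ^ 2) :
    ∑' i, f i * g i ≤ √(∑' i, f i ^ 2) * √(∑' i, g i ^ 2) := by
  have := Real.inner_le_Lp_mul_Lq_tsum_of_nonneg Real.HolderConjugate.two_two hf hg
    (by simpa using hf2) (by simpa using hg2)
  simpa [Real.sqrt_eq_rpow] using this

/-- The trilinear estimate `ℓ¹ × ℓ² × ℓ² → ℝ`: for each value of the variable of `f`, the other two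
families are paired by the Cauchy–Schwarz inequality, along a permutation. -/
theorem summable_tri {X : Type*} {f g h : X → ℝ} (φ : X → Equiv.Perm X)
    (hf : ∀ i, 0 ≤ f i) (hg : ∀ i, 0 ≤ g i) (hh : ∀ i, 0 ≤ h i) (hf1 : Summable f)
    (hg2 : Summable fun i => g i ^ 2) (hh2 : Summable fun i => h i ^ 2) :
    (Summable fun x : X × X => f x.1 * (g x.2 * h (φ x.1 x.2))) ∧
      ∑' x : X × X, f x.1 * (g x.2 * h (φ x.1 x.2))
        ≤ (∑' i, f i) * (√(∑' i, g i ^ 2) * √(∑' i, h i ^ 2)) := by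
  have hin (x : X) : Summable (fun y => h (φ x y) ^ 2) := ((φ x).summable_iff).2 hh2
  have hin1 (x : X) : Summable (fun y => g y * h (φ x y)) := summable_mul_of_sq hg2 (hin x)
  have hle (x : X) : ∑' y, f x * (g y * h (φ x y))
      ≤ f x * (√(∑' i, g i ^ 2) * √(∑' i, h i ^ 2)) := by
    rw [tsum_mul_left]
    refine mul_le_mul_of_nonneg_left ?_ (hf x)
    rw [← (φ x).tsum_eq (fun y => h y ^ 2)]
    exact tsum_mul_le_sqrt hg (fun y => hh _) hg2 (hin x)
  have h0 (x y : X) : 0 ≤ f x * (g y * h (φ x y)) :=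
    mul_nonneg (hf x) (mul_nonneg (hg y) (hh _))
  have hs : Summable fun x => ∑' y, f x * (g y * h (φ x y)) :=
    Summable.of_nonneg_of_le (fun x => tsum_nonneg (h0 x)) hle (hf1.mul_right _)
  have hS : Summable fun x : X × X => f x.1 * (g x.2 * h (φ x.1 x.2)) := by
    refine (summable_prod_of_nonneg (f := fun x : X × X => f x.1 * (g x.2 * h (φ x.1 x.2)))
      (fun x => h0 x.1 x.2)).2 ⟨fun x => (hin1 x).mul_left (f x), hs⟩
  refine ⟨hS, ?_⟩
  rw [hS.tsum_prod, ← tsum_mul_right]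
  exact hs.tsum_le_tsum hle (hf1.mul_right _)

section Convolution

variable {G : Type*} [AddCommGroup G] {A B C : G → ℝ}

theorem summable_tri_left (hA : ∀ i, 0 ≤ A i) (hB : ∀ i, 0 ≤ B i) (hC : ∀ i, 0 ≤ C i)
    (hA2 : Summable fun i => A i ^ 2) (hB1 : Summable B) (hC2 : Summable fun i => C i ^ 2) :
    (Summable fun x : G × G => A (x.1 + x.2) * (B x.1 * C x.2)) ∧
      ∑' x : G × G, A (x.1 + x.2) * (B x.1 * C x.2)
        ≤ √(∑' i, A i ^ 2) * ((∑' i, B i) * √(∑' i, C i ^ 2)) := by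
  have := summable_tri (fun x => Equiv.addLeft x) hB hC hA hB1 hC2 hA2
  have he : (fun x : G × G => A (x.1 + x.2) * (B x.1 * C x.2))
      = fun x : G × G => B x.1 * (C x.2 * A (Equiv.addLeft x.1 x.2)) := by
    funext x; simp only [Equiv.coe_addLeft]; ring
  rw [he]
  exact ⟨this.1, this.2.trans_eq (by ring)⟩

theorem summable_tri_right (hA : ∀ i, 0 ≤ A i) (hB : ∀ i, 0 ≤ B i) (hC : ∀ i, 0 ≤ C i)
    (hA2 : Summable fun i => A i ^ 2) (hB2 : Summable fun i => B i ^ 2) (hC1 : Summable C) :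
    (Summable fun x : G × G => A (x.1 + x.2) * (B x.1 * C x.2)) ∧
      ∑' x : G × G, A (x.1 + x.2) * (B x.1 * C x.2)
        ≤ √(∑' i, A i ^ 2) * (√(∑' i, B i ^ 2) * ∑' i, C i) := by
  have := summable_tri_left hA hC hB hA2 hC1 hB2
  have he : (fun x : G × G => A (x.1 + x.2) * (B x.1 * C x.2))
      = (fun x : G × G => A (x.1 + x.2) * (C x.1 * B x.2)) ∘ (Equiv.prodComm G G) := by
    funext x; simp only [Function.comp, Equiv.prodComm_apply, Prod.swap]; rw [add_comm]; ring
  rw [he, Equiv.summable_iff]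
  simp only [Function.comp_def]
  rw [Equiv.tsum_eq (Equiv.prodComm G G) (fun x : G × G => A (x.1 + x.2) * (C x.1 * B x.2))]
  exact ⟨this.1, this.2.trans_eq (by ring)⟩

theorem summable_tri_sum (hA : ∀ i, 0 ≤ A i) (hB : ∀ i, 0 ≤ B i) (hC : ∀ i, 0 ≤ C i)
    (hA1 : Summable A) (hB2 : Summable fun i => B i ^ 2) (hC2 : Summable fun i => C i ^ 2) :
    (Summable fun x : G × G => A (x.1 + x.2) * (B x.1 * C x.2)) ∧
      ∑' x : G × G, A (x.1 + x.2) * (B x.1 * C x.2)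
        ≤ (∑' i, A i) * (√(∑' i, B i ^ 2) * √(∑' i, C i ^ 2)) := by
  have := summable_tri (fun x => Equiv.subLeft x) hA hB hC hA1 hB2 hC2
  let e : G × G ≃ G × G :=
    { toFun := fun x => (x.1 + x.2, x.1)
      invFun := fun x => (x.2, x.1 - x.2)
      left_inv := fun x => by simp
      right_inv := fun x => by simp }
  have he : (fun x : G × G => A (x.1 + x.2) * (B x.1 * C x.2))
      = (fun x : G × G => A x.1 * (B x.2 * C (Equiv.subLeft x.1 x.2))) ∘ e := by
    funext x; simp [e]
  rw [he, Equiv.summable_iff]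
  simp only [Function.comp_def]
  rw [Equiv.tsum_eq e (fun x : G × G => A x.1 * (B x.2 * C (Equiv.subLeft x.1 x.2)))]
  exact this

/-- Young's inequality for the convolution of a square summable and a summable family. -/
theorem sq_conv_le (hB : ∀ i, 0 ≤ B i) (hC : ∀ i, 0 ≤ C i)
    (hB2 : Summable fun i => B i ^ 2) (hC1 : Summable C) :
    (Summable fun k => (∑' h, B h * C (k - h)) ^ 2) ∧
      ∑' k, (∑' h, B h * C (k - h)) ^ 2 ≤ (∑' i, C i) ^ 2 * ∑' i, B i ^ 2 := by
  have hprod : Summable fun x : G × G => B x.1 ^ 2 * C x.2 :=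
    hB2.mul_of_nonneg hC1 (fun _ => sq_nonneg _) hC
  let e : G × G ≃ G × G :=
    { toFun := fun x => (x.2, x.1 - x.2)
      invFun := fun x => (x.1 + x.2, x.1)
      left_inv := fun x => by simp
      right_inv := fun x => by simp }
  have hS : Summable fun x : G × G => B x.2 ^ 2 * C (x.1 - x.2) := (e.summable_iff).2 hprod
  have hval : ∑' k, ∑' h, B h ^ 2 * C (k - h) = (∑' i, B i ^ 2) * ∑' i, C i := by
    rw [← hS.tsum_prod, hB2.tsum_mul_tsum hC1 hprod,
      ← e.tsum_eq (fun x : G × G => B x.1 ^ 2 * C x.2)]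
    rfl
  have hCk (k : G) : Summable fun h => C (k - h) := ((Equiv.subLeft k).summable_iff).2 hC1
  have hCv (k : G) : ∑' h, C (k - h) = ∑' h, C h := (Equiv.subLeft k).tsum_eq C
  have hle (k : G) : (∑' h, B h * C (k - h)) ^ 2
      ≤ (∑' i, C i) * ∑' h, B h ^ 2 * C (k - h) := by
    have h1 : ∀ h, (B h * √(C (k - h))) * √(C (k - h)) = B h * C (k - h) := fun h => by
      rw [mul_assoc, Real.mul_self_sqrt (hC _)]
    have h2 : ∀ h, (B h * √(C (k - h))) ^ 2 = B h ^ 2 * C (k - h) := fun h => by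
      rw [mul_pow, Real.sq_sqrt (hC _)]
    have h3 : ∀ h, √(C (k - h)) ^ 2 = C (k - h) := fun h => Real.sq_sqrt (hC _)
    have hf := hS.prod_factor k
    have := tsum_mul_le_sqrt (f := fun h => B h * √(C (k - h))) (g := fun h => √(C (k - h)))
      (fun h => mul_nonneg (hB _) (Real.sqrt_nonneg _)) (fun h => Real.sqrt_nonneg _)
      (by simpa only [h2] using hf) (by simpa only [h3] using hCk k)
    simp only [h1, h2, h3, hCv] at this
    have h0 : 0 ≤ ∑' h, B h * C (k - h) := tsum_nonneg fun h => mul_nonneg (hB _) (hC _)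
    calc (∑' h, B h * C (k - h)) ^ 2
        ≤ (√(∑' h, B h ^ 2 * C (k - h)) * √(∑' h, C h)) ^ 2 := by gcongr
      _ = _ := by
        rw [mul_pow, Real.sq_sqrt (tsum_nonneg hC),
          Real.sq_sqrt (tsum_nonneg fun h => mul_nonneg (sq_nonneg _) (hC _)), mul_comm]
  have hs := hS.prod.mul_left (∑' i, C i)
  have hs2 := Summable.of_nonneg_of_le (fun k => sq_nonneg _) hle hs
  refine ⟨hs2, (hs2.tsum_le_tsum hle hs).trans_eq ?_⟩
  rw [tsum_mul_left, hval]; ring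

end Convolution

/-! ### Weights -/

/-- A power of a sum of two numbers is controlled by the sum of the powers. -/
theorem rpow_le_of_le_add {a b c p : ℝ} (ha : 0 ≤ a) (hb : 0 ≤ b) (hc : 0 ≤ c) (hp : 0 ≤ p)
    (h : a ≤ b + c) : a ^ p ≤ 2 ^ p * (b ^ p + c ^ p) := by
  have hb' := Real.rpow_nonneg hb p
  have hc' := Real.rpow_nonneg hc p
  have h2 : (0 : ℝ) ≤ 2 ^ p := by positivity
  rcases le_total b c with hbc | hbc
  · calc a ^ p ≤ (2 * c) ^ p := Real.rpow_le_rpow ha (by linarith) hp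
      _ = 2 ^ p * c ^ p := Real.mul_rpow (by norm_num) hc
      _ ≤ _ := by gcongr; linarith
  · calc a ^ p ≤ (2 * b) ^ p := Real.rpow_le_rpow ha (by linarith) hp
      _ = 2 ^ p * b ^ p := Real.mul_rpow (by norm_num) hb
      _ ≤ _ := by gcongr; linarith

/-- The tangent line bound for the convex function `x ↦ x ^ p`, a form of Bernoulli's
inequality. -/
theorem rpow_sub_rpow_le {a b p : ℝ} (hb : 0 ≤ b) (ha : 0 < a) (hp : 1 ≤ p) :
    a ^ p - b ^ p ≤ p * a ^ (p - 1) * (a - b) := by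
  have h := one_add_mul_self_le_rpow_one_add (s := b / a - 1)
    (by have := div_nonneg hb ha.le; linarith) hp
  have h1 : 1 + (b / a - 1) = b / a := by ring
  rw [h1, Real.div_rpow hb ha.le, le_div_iff₀ (by positivity)] at h
  have h2 : a ^ (p - 1) = a ^ p / a := Real.rpow_sub_one ha.ne' p
  rw [h2]
  have h3 : p * (a ^ p / a) * (a - b) = a ^ p - (1 + p * (b / a - 1)) * a ^ p := by
    field_simp; ring
  linarith

/-- The case `b ≤ a` of `kato_weight`: the mean value bound for `a ^ p - b ^ p` leaves the factor
`a ^ (p - 1)`, which is at most `(2 * max b h) ^ (p - 1)`. -/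
theorem kato_weight_of_le {a b h p : ℝ} (hb : 0 ≤ b) (hh : 0 ≤ h) (hba : b ≤ a)
    (hab : a ≤ b + h) (hp : 1 ≤ p) :
    (a ^ (2 * p) - b ^ (2 * p)) * b
      ≤ p * 2 ^ p * (a ^ p * b ^ p * h + a ^ p * h ^ p * b) := by
  have ha : 0 ≤ a := hb.trans hba
  rcases hb.eq_or_lt with rfl | hb
  · rw [mul_zero]; positivity
  have ha : 0 < a := hb.trans_le hba
  have h2p (x : ℝ) (hx : 0 < x) : x ^ (2 * p) = x ^ p * x ^ p := by
    rw [two_mul, Real.rpow_add hx]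
  have hm : b ^ p ≤ a ^ p := Real.rpow_le_rpow hb.le hba (by linarith)
  have hap : 0 < a ^ p := by positivity
  have hpm1 : ∀ x : ℝ, 0 < x → x ^ (p - 1) * x = x ^ p := fun x hx => by
    rw [Real.rpow_sub_one hx.ne']; field_simp
  have key : a ^ (p - 1) * h * b ≤ 2 ^ (p - 1) * (b ^ p * h + h ^ p * b) := by
    have h2 : (0 : ℝ) < 2 ^ (p - 1) := by positivity
    rcases le_total h b with hhb | hhb
    · have : a ^ (p - 1) ≤ 2 ^ (p - 1) * b ^ (p - 1) := by
        rw [← Real.mul_rpow (by norm_num) hb.le]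
        exact Real.rpow_le_rpow ha.le (by linarith) (by linarith)
      calc a ^ (p - 1) * h * b ≤ 2 ^ (p - 1) * b ^ (p - 1) * h * b := by gcongr
        _ = 2 ^ (p - 1) * (b ^ (p - 1) * b * h) := by ring
        _ = 2 ^ (p - 1) * (b ^ p * h) := by rw [hpm1 b hb]
        _ ≤ _ := by gcongr; linarith [mul_nonneg (Real.rpow_nonneg hh p) hb.le]
    · have hh' : 0 < h := hb.trans_le hhb
      have : a ^ (p - 1) ≤ 2 ^ (p - 1) * h ^ (p - 1) := by
        rw [← Real.mul_rpow (by norm_num) hh]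
        exact Real.rpow_le_rpow ha.le (by linarith) (by linarith)
      calc a ^ (p - 1) * h * b ≤ 2 ^ (p - 1) * h ^ (p - 1) * h * b := by gcongr
        _ = 2 ^ (p - 1) * (h ^ (p - 1) * h * b) := by ring
        _ = 2 ^ (p - 1) * (h ^ p * b) := by rw [hpm1 h hh']
        _ ≤ _ := by gcongr; linarith [mul_nonneg (Real.rpow_nonneg hb.le p) hh]
  have hd : a ^ p - b ^ p ≤ p * a ^ (p - 1) * h :=
    (rpow_sub_rpow_le hb.le ha hp).trans (by gcongr; linarith)
  calc (a ^ (2 * p) - b ^ (2 * p)) * b = (a ^ p - b ^ p) * (a ^ p + b ^ p) * b := by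
        rw [h2p a ha, h2p b hb]; ring
    _ ≤ (p * a ^ (p - 1) * h) * (2 * a ^ p) * b := by
        gcongr
        linarith
    _ = p * 2 * a ^ p * (a ^ (p - 1) * h * b) := by ring
    _ ≤ p * 2 * a ^ p * (2 ^ (p - 1) * (b ^ p * h + h ^ p * b)) := by gcongr
    _ = p * (2 ^ (p - 1) * 2) * (a ^ p * b ^ p * h + a ^ p * h ^ p * b) := by ring
    _ = _ := by rw [hpm1 2 (by norm_num)]

/-- The commutator weight: the gain of one derivative in `a^{2p} - b^{2p}`, together with
the factor `min a b`, distributes the `2p + 1` derivatives in a tame way. -/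
theorem kato_weight {a b h p : ℝ} (ha : 0 ≤ a) (hb : 0 ≤ b) (hh : 0 ≤ h)
    (hab : a ≤ b + h) (hba : b ≤ a + h) (hp : 1 ≤ p) :
    |a ^ (2 * p) - b ^ (2 * p)| * min a b
      ≤ p * 2 ^ p * (a ^ p * b ^ p * h + a ^ p * h ^ p * b + b ^ p * h ^ p * a) := by
  have h1 : 0 ≤ p * 2 ^ p * (b ^ p * h ^ p * a) := by positivity
  have h2 : 0 ≤ p * 2 ^ p * (a ^ p * h ^ p * b) := by positivity
  rcases le_total b a with hle | hle
  · have := kato_weight_of_le hb hh hle hab hp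
    rw [min_eq_right hle, abs_of_nonneg
      (sub_nonneg.2 (Real.rpow_le_rpow hb hle (by linarith)))]
    linarith
  · have := kato_weight_of_le ha hh hle hba hp
    rw [min_eq_left hle, abs_sub_comm, abs_of_nonneg
      (sub_nonneg.2 (Real.rpow_le_rpow ha hle (by linarith)))]
    linarith

variable {d : ℕ}

/-! ### Sobolev norms as sums over the whole lattice -/

/-- The weighted modulus `|k|^p ‖v_k‖`, whose `ℓ²` norm is `‖v‖_p`. -/
def wt (p : ℝ) (v : Coeffs d) (k : Fin d → ℤ) : ℝ := latNorm k ^ p * ‖v k‖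

theorem wt_nonneg (p : ℝ) (v : Coeffs d) (k : Fin d → ℤ) : 0 ≤ wt p v k :=
  mul_nonneg (Real.rpow_nonneg (latNorm_nonneg k) p) (norm_nonneg _)

theorem latNorm_rpow_two_mul (p : ℝ) (k : Fin d → ℤ) :
    latNorm k ^ (2 * p) = (latNorm k ^ p) ^ 2 := by
  rw [mul_comm, Real.rpow_mul (latNorm_nonneg k), Real.rpow_two]

theorem wt_sq (p : ℝ) (v : Coeffs d) (k : Fin d → ℤ) :
    wt p v k ^ 2 = latNorm k ^ (2 * p) * ‖v k‖ ^ 2 := by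
  rw [wt, mul_pow, latNorm_rpow_two_mul]

theorem support_subset_ne_zero {F : (Fin d → ℤ) → ℝ} (hF : F 0 = 0) :
    Function.support F ⊆ {k : Fin d → ℤ | k ≠ 0} := fun k hk h0 => hk (by rw [h0]; exact hF)

theorem summable_ne_zero_iff {F : (Fin d → ℤ) → ℝ} (hF : F 0 = 0) :
    (Summable fun k : {k : Fin d → ℤ // k ≠ 0} => F k.1) ↔ Summable F :=
  Subtype.val_injective.summable_iff (f := F) fun k hk => by
    have : k = 0 := by simpa using hk
    rw [this, hF]

theorem hinner_eq_tsum {p : ℝ} {v w : Coeffs d} (h0 : w 0 = 0) :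
    hinner p v w = ∑' k, latNorm k ^ (2 * p) * (inner ℂ (v k) (w k)).re :=
  tsum_subtype_eq_of_support_subset
    (f := fun k => latNorm k ^ (2 * p) * (inner ℂ (v k) (w k)).re)
    (support_subset_ne_zero (by simp [h0]))

theorem hinner_self {p : ℝ} {v : Coeffs d} (h0 : v 0 = 0) :
    hinner p v v = ∑' k, wt p v k ^ 2 := by
  rw [hinner_eq_tsum h0]
  refine tsum_congr fun k => ?_
  rw [wt_sq, inner_self_eq_norm_sq_to_K]
  norm_cast

theorem hnorm_eq {p : ℝ} {v : Coeffs d} (h0 : v 0 = 0) :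
    hnorm p v = √(∑' k, wt p v k ^ 2) := by rw [hnorm, hinner_self h0]

theorem hnorm_nonneg (p : ℝ) (v : Coeffs d) : 0 ≤ hnorm p v := Real.sqrt_nonneg _

theorem HM.map_zero {p : ℝ} {v : Coeffs d} (hv : v ∈ HM d p) : v 0 = 0 := hv.2.2.1

theorem HM.conj {p : ℝ} {v : Coeffs d} (hv : v ∈ HM d p) (k : Fin d → ℤ) (r : Fin d) :
    v (-k) r = (starRingEnd ℂ) (v k r) := hv.1.1 k r

theorem HM.latDot_eq {p : ℝ} {v : Coeffs d} (hv : v ∈ HM d p) (k : Fin d → ℤ) :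
    latDot k (v k) = 0 := hv.2.1 k

theorem HM.summable {p : ℝ} {v : Coeffs d} (hv : v ∈ HM d p) :
    Summable fun k => wt p v k ^ 2 := by
  refine (summable_ne_zero_iff (by simp [wt, (HM.map_zero hv)])).1 ?_
  simpa only [wt_sq] using hv.2.2.2

theorem HM.mk {p : ℝ} {v : Coeffs d} (hd : IsDistribution v) (hdiv : ∀ k, latDot k (v k) = 0)
    (h0 : v 0 = 0) (hs : Summable fun k => wt p v k ^ 2) : v ∈ HM d p := by
  refine ⟨hd, hdiv, h0, ?_⟩
  simpa only [wt_sq] using (summable_ne_zero_iff (by simp [wt, h0])).2 hs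

theorem wt_mono {p q : ℝ} (hqp : q ≤ p) {v : Coeffs d} (h0 : v 0 = 0) (k : Fin d → ℤ) :
    wt q v k ≤ wt p v k := by
  rcases eq_or_ne k 0 with rfl | hk
  · simp [wt, h0]
  · exact mul_le_mul_of_nonneg_right
      (Real.rpow_le_rpow_of_exponent_le (one_le_latNorm hk) hqp) (norm_nonneg _)

theorem HM.mono {p q : ℝ} (hqp : q ≤ p) {v : Coeffs d} (hv : v ∈ HM d p) : v ∈ HM d q :=
  HM.mk hv.1 hv.2.1 (HM.map_zero hv) <| Summable.of_nonneg_of_le (fun _ => sq_nonneg _)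
    (fun k => pow_le_pow_left₀ (wt_nonneg _ _ _) (wt_mono hqp (HM.map_zero hv) k) 2)
    (HM.summable hv)

theorem hnorm_mono {p q : ℝ} (hqp : q ≤ p) {v : Coeffs d} (hv : v ∈ HM d p) :
    hnorm q v ≤ hnorm p v := by
  rw [hnorm_eq (HM.map_zero hv), hnorm_eq (HM.map_zero hv)]
  exact Real.sqrt_le_sqrt <| Summable.tsum_le_tsum
    (fun k => pow_le_pow_left₀ (wt_nonneg _ _ _) (wt_mono hqp (HM.map_zero hv) k) 2)
    (HM.summable (HM.mono hqp hv)) (HM.summable hv)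

/-- The constant of the embedding of the Sobolev space of order `n > d / 2 + 1` into
the fields with absolutely summable first derivatives. -/
def embedConst (d : ℕ) (n : ℝ) : ℝ := √(∑' k : Fin d → ℤ, (latNorm k ^ (1 - n)) ^ 2)

theorem embedConst_nonneg (d : ℕ) (n : ℝ) : 0 ≤ embedConst d n := Real.sqrt_nonneg _

/-- The Sobolev embedding: above the order `d / 2 + 1` the first derivatives have absolutely
summable Fourier coefficients. -/
theorem HM.summable_one {n : ℝ} (hn : (d : ℝ) / 2 + 1 < n) {v : Coeffs d} (hv : v ∈ HM d n) :
    (Summable fun k => latNorm k * ‖v k‖) ∧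
      ∑' k, latNorm k * ‖v k‖ ≤ embedConst d n * hnorm n v := by
  have hs : Summable fun k : Fin d → ℤ => (latNorm k ^ (1 - n)) ^ 2 := by
    simp only [← latNorm_rpow_two_mul]
    exact summable_latNorm_rpow (by linarith)
  have he : (fun k => latNorm k * ‖v k‖) = fun k => latNorm k ^ (1 - n) * wt n v k := by
    funext k
    rcases eq_or_ne k 0 with rfl | hk
    · simp [wt, (HM.map_zero hv)]
    · rw [wt, ← mul_assoc, ← Real.rpow_add (latNorm_pos hk), sub_add_cancel, Real.rpow_one]
  rw [he, embedConst, hnorm_eq (HM.map_zero hv)]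
  exact ⟨summable_mul_of_sq hs (HM.summable hv),
    tsum_mul_le_sqrt (fun k => Real.rpow_nonneg (latNorm_nonneg k) _) (wt_nonneg _ _)
      hs (HM.summable hv)⟩

/-- Zero mean fields with absolutely summable first derivatives. -/
def IsLip (v : Coeffs d) : Prop := v 0 = 0 ∧ Summable fun k => latNorm k * ‖v k‖

theorem HM.isLip {n : ℝ} (hn : (d : ℝ) / 2 + 1 < n) {v : Coeffs d} (hv : v ∈ HM d n) :
    IsLip v := ⟨(HM.map_zero hv), (HM.summable_one hn hv).1⟩

theorem norm_le_latNorm_mul {v : Coeffs d} (h0 : v 0 = 0) (k : Fin d → ℤ) :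
    ‖v k‖ ≤ latNorm k * ‖v k‖ := by
  rcases eq_or_ne k 0 with rfl | hk
  · simp [h0]
  · exact le_mul_of_one_le_left (norm_nonneg _) (one_le_latNorm hk)

theorem IsLip.summable_norm {v : Coeffs d} (hv : IsLip v) : Summable fun k => ‖v k‖ :=
  Summable.of_nonneg_of_le (fun _ => norm_nonneg _) (norm_le_latNorm_mul hv.1) hv.2

theorem IsLip.add {v w : Coeffs d} (hv : IsLip v) (hw : IsLip w) : IsLip (v + w) := by
  refine ⟨by simp [hv.1, hw.1], Summable.of_nonneg_of_le
    (fun k => mul_nonneg (latNorm_nonneg k) (norm_nonneg _)) (fun k => ?_) (hv.2.add hw.2)⟩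
  rw [← mul_add]
  exact mul_le_mul_of_nonneg_left (norm_add_le _ _) (latNorm_nonneg k)

/-! ### The advection term and the Leray projection -/

theorem latDot_add (k : Fin d → ℤ) (a b : EuclideanSpace ℂ (Fin d)) :
    latDot k (a + b) = latDot k a + latDot k b := by
  simp [latDot, mul_add, Finset.sum_add_distrib]

theorem latDot_smul (k : Fin d → ℤ) (c : ℂ) (a : EuclideanSpace ℂ (Fin d)) :
    latDot k (c • a) = c * latDot k a := by
  simp [latDot, Finset.mul_sum, mul_left_comm]

theorem latDot_add_left (h l : Fin d → ℤ) (a : EuclideanSpace ℂ (Fin d)) :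
    latDot (h + l) a = latDot h a + latDot l a := by
  simp [latDot, add_mul, Finset.sum_add_distrib]

/-- The lattice point `k` as a vector of `ℂ^d`. -/
def cVec (k : Fin d → ℤ) : EuclideanSpace ℂ (Fin d) := WithLp.toLp 2 fun i => (k i : ℂ)

theorem norm_cVec (k : Fin d → ℤ) : ‖cVec k‖ = latNorm k := by
  simp [latNorm, cVec, EuclideanSpace.norm_eq]

theorem latDot_eq_inner (k : Fin d → ℤ) (a : EuclideanSpace ℂ (Fin d)) :
    latDot k a = inner ℂ (cVec k) a := by
  simp [latDot, cVec, PiLp.inner_apply, mul_comm]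

theorem norm_latDot_le (k : Fin d → ℤ) (a : EuclideanSpace ℂ (Fin d)) :
    ‖latDot k a‖ ≤ latNorm k * ‖a‖ := by
  rw [latDot_eq_inner, ← norm_cVec]
  exact norm_inner_le_norm _ _

theorem leray_apply (a : Coeffs d) (k : Fin d → ℤ) :
    leray a k = a k - (latDot k (a k) / ((latNorm k ^ 2 : ℝ) : ℂ)) • cVec k := by
  ext r
  simp [leray, cVec]
  ring

/-- A crude bound (the projection is a contraction), sufficient for finding some constant. -/
theorem norm_leray_le (a : Coeffs d) (k : Fin d → ℤ) : ‖leray a k‖ ≤ 2 * ‖a k‖ := by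
  rcases eq_or_ne k 0 with rfl | hk
  · rw [leray_apply]
    simp
    linarith [norm_nonneg (a 0)]
  have hk' := latNorm_pos hk
  rw [leray_apply, two_mul]
  refine (norm_sub_le _ _).trans (add_le_add_right ?_ _)
  rw [norm_smul, norm_div, norm_cVec, Complex.norm_real, Real.norm_of_nonneg (by positivity),
    div_mul_eq_mul_div, div_le_iff₀ (by positivity)]
  calc ‖latDot k (a k)‖ * latNorm k ≤ latNorm k * ‖a k‖ * latNorm k := by
        gcongr; exact norm_latDot_le _ _
    _ = _ := by ring

theorem latDot_cVec (k : Fin d → ℤ) : latDot k (cVec k) = ((latNorm k ^ 2 : ℝ) : ℂ) := by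
  rw [latNorm_sq]
  simp [latDot, cVec, sq]

theorem latDot_leray (a : Coeffs d) (k : Fin d → ℤ) : latDot k (leray a k) = 0 := by
  rcases eq_or_ne k 0 with rfl | hk
  · simp [latDot]
  have hk' : ((latNorm k ^ 2 : ℝ) : ℂ) ≠ 0 := by
    exact_mod_cast (pow_pos (latNorm_pos hk) 2).ne'
  rw [leray_apply, sub_eq_add_neg, latDot_add, ← neg_smul, latDot_smul, latDot_cVec]
  field_simp
  ring

/-- The Leray projection is invisible when tested against divergence free fields. -/
theorem inner_leray (a : Coeffs d) (k : Fin d → ℤ) {z : EuclideanSpace ℂ (Fin d)}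
    (hz : latDot k z = 0) : inner ℂ (leray a k) z = inner ℂ (a k) z := by
  rw [leray_apply, inner_sub_left, inner_smul_left, ← latDot_eq_inner, hz, mul_zero, sub_zero]

theorem leray_add (a b : Coeffs d) : leray (a + b) = leray a + leray b := by
  funext k
  simp only [Pi.add_apply, leray_apply, latDot_add, add_div, add_smul]
  abel

/-- The contribution `i ((k - h) • v_h) w_{k-h}` of the mode `h` of `v` to the mode `k` of
`v • ∂w`, up to the normalization of the basis `e_k`. -/
def advTerm (v w : Coeffs d) (k h : Fin d → ℤ) : EuclideanSpace ℂ (Fin d) :=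
  (Complex.I * latDot (k - h) (v h)) • w (k - h)

theorem norm_advTerm_le (v w : Coeffs d) (k h : Fin d → ℤ) :
    ‖advTerm v w k h‖ ≤ ‖v h‖ * (latNorm (k - h) * ‖w (k - h)‖) := by
  rw [advTerm, norm_smul, norm_mul, Complex.norm_I, one_mul]
  calc _ ≤ latNorm (k - h) * ‖v h‖ * ‖w (k - h)‖ := by
        gcongr; exact norm_latDot_le _ _
    _ = _ := by ring

theorem summable_conv {v w : Coeffs d} (hv : IsLip v) (hw : IsLip w) (k : Fin d → ℤ) :
    Summable fun h => ‖v h‖ * (latNorm (k - h) * ‖w (k - h)‖) := by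
  have hk : Summable fun h => latNorm (k - h) * ‖w (k - h)‖ :=
    ((Equiv.subLeft k).summable_iff).2 hw.2
  refine Summable.of_nonneg_of_le
    (fun h => mul_nonneg (norm_nonneg _) (mul_nonneg (latNorm_nonneg _) (norm_nonneg _)))
    (fun h => ?_) (hk.mul_left (∑' h, ‖v h‖))
  exact mul_le_mul_of_nonneg_right
    (hv.summable_norm.le_tsum h fun _ _ => norm_nonneg _)
    (mul_nonneg (latNorm_nonneg _) (norm_nonneg _))

theorem summable_advTerm {v w : Coeffs d} (hv : IsLip v) (hw : IsLip w) (k : Fin d → ℤ) :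
    Summable (advTerm v w k) :=
  Summable.of_norm_bounded (summable_conv hv hw k) (norm_advTerm_le v w k)

/-- The normalization constant `(2π)^{-d/2}` of the product of functions. -/
def normConst (d : ℕ) : ℝ := (2 * Real.pi) ^ (-(d : ℝ) / 2)

theorem normConst_pos (d : ℕ) : 0 < normConst d := Real.rpow_pos_of_pos (by positivity) _

/-- The Fourier coefficients of `v • ∂w` as vector valued sums over the modes of `v`. -/
theorem advect_eq {v w : Coeffs d} (hv : IsLip v) (hw : IsLip w) (k : Fin d → ℤ) :
    advect v w k = (normConst d : ℂ) • ∑' h, advTerm v w k h := by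
  have hs (s r : Fin d) :
      Summable fun h => v h s * (Complex.I * ((k - h) s : ℂ) * w (k - h) r) := by
    refine Summable.of_norm_bounded (summable_conv hv hw k) fun h => ?_
    have h1 : ‖v h s‖ ≤ ‖v h‖ := PiLp.norm_apply_le _ _
    have h2 : ‖w (k - h) r‖ ≤ ‖w (k - h)‖ := PiLp.norm_apply_le _ _
    have h3 : ‖(((k - h) s : ℤ) : ℂ)‖ ≤ latNorm (k - h) := by
      rw [← norm_cVec]; exact PiLp.norm_apply_le (cVec (k - h)) s
    have h4 := latNorm_nonneg (k - h)
    rw [norm_mul, norm_mul, norm_mul, Complex.norm_I, one_mul]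
    gcongr
  ext r
  have hr : (∑' h, advTerm v w k h) r = ∑' h, advTerm v w k h r :=
    ((EuclideanSpace.proj (𝕜 := ℂ) r : EuclideanSpace ℂ (Fin d) →L[ℂ] ℂ).hasSum
      (summable_advTerm hv hw k).hasSum).tsum_eq.symm
  simp only [advect, mulCoeffs, partialDeriv, PiLp.smul_apply, smul_eq_mul, hr]
  rw [← Finset.mul_sum, ← Summable.tsum_finsetSum fun s _ => hs s r]
  congr 1
  refine tsum_congr fun h => ?_
  simp only [advTerm, latDot, PiLp.smul_apply, smul_eq_mul, Finset.mul_sum, Finset.sum_mul]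
  exact Finset.sum_congr rfl fun s _ => by ring

theorem norm_advect_le {v w : Coeffs d} (hv : IsLip v) (hw : IsLip w) (k : Fin d → ℤ) :
    ‖advect v w k‖ ≤ normConst d * ∑' h, ‖v h‖ * (latNorm (k - h) * ‖w (k - h)‖) := by
  rw [advect_eq hv hw, norm_smul, Complex.norm_real, Real.norm_of_nonneg (normConst_pos d).le]
  exact mul_le_mul_of_nonneg_left
    (tsum_of_norm_bounded (summable_conv hv hw k).hasSum (norm_advTerm_le v w k))
    (normConst_pos d).le

theorem advect_add_left {v v' w : Coeffs d} (hv : IsLip v) (hv' : IsLip v') (hw : IsLip w) :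
    advect (v + v') w = advect v w + advect v' w := by
  funext k
  rw [Pi.add_apply, advect_eq (hv.add hv') hw, advect_eq hv hw, advect_eq hv' hw, ← smul_add,
    ← (summable_advTerm hv hw k).tsum_add (summable_advTerm hv' hw k)]
  congr 1
  refine tsum_congr fun h => ?_
  simp only [advTerm, Pi.add_apply, latDot_add, mul_add, add_smul]

theorem advect_add_right {v w w' : Coeffs d} (hv : IsLip v) (hw : IsLip w) (hw' : IsLip w') :
    advect v (w + w') = advect v w + advect v w' := by
  funext k
  rw [Pi.add_apply, advect_eq hv (hw.add hw'), advect_eq hv hw, advect_eq hv hw', ← smul_add,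
    ← (summable_advTerm hv hw k).tsum_add (summable_advTerm hv hw' k)]
  congr 1
  refine tsum_congr fun h => ?_
  simp only [advTerm, Pi.add_apply, smul_add]

theorem bilin_add_left {v v' w : Coeffs d} (hv : IsLip v) (hv' : IsLip v') (hw : IsLip w) :
    bilin (v + v') w = bilin v w + bilin v' w := by
  rw [bilin, advect_add_left hv hv' hw, leray_add, neg_add]; rfl

theorem bilin_add_right {v w w' : Coeffs d} (hv : IsLip v) (hw : IsLip w) (hw' : IsLip w') :
    bilin v (w + w') = bilin v w + bilin v w' := by
  rw [bilin, advect_add_right hv hw hw', leray_add, neg_add]; rfl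

/-! ### The basic estimate -/

theorem norm_bilin_le {v w : Coeffs d} (hv : IsLip v) (hw : IsLip w) (k : Fin d → ℤ) :
    ‖bilin v w k‖
      ≤ 2 * normConst d * ∑' h, ‖v h‖ * (latNorm (k - h) * ‖w (k - h)‖) := by
  rw [bilin, Pi.neg_apply, norm_neg, mul_assoc]
  exact (norm_leray_le _ k).trans
    (mul_le_mul_of_nonneg_left (norm_advect_le hv hw k) zero_le_two)

theorem one_wt {p : ℝ} (hp : 0 ≤ p) (w : Coeffs d) (k : Fin d → ℤ) :
    latNorm k ^ p * (latNorm k * ‖w k‖) = wt (p + 1) w k := by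
  rw [wt, Real.rpow_add_one' (latNorm_nonneg k) (by linarith)]; ring

/-- The convolution estimate behind the boundedness of the bilinear map: the derivatives of
order `p` fall either on `v` or on `∂w`. -/
theorem wt_bilin_le {p : ℝ} (hp : (d : ℝ) / 2 + 1 < p) {v w : Coeffs d} (hv : v ∈ HM d p)
    (hw : w ∈ HM d (p + 1)) (k : Fin d → ℤ) :
    wt p (bilin v w) k ≤ 2 * normConst d * 2 ^ p *
      (∑' h, wt p v h * (latNorm (k - h) * ‖w (k - h)‖)
        + ∑' h, wt (p + 1) w h * (latNorm (k - h) * ‖v (k - h)‖)) := by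
  have hp0 : 0 ≤ p := by have : (0 : ℝ) ≤ d := Nat.cast_nonneg d; linarith
  have hp1 : 1 ≤ p := by have : (0 : ℝ) ≤ d := Nat.cast_nonneg d; linarith
  have hvL := HM.isLip hp hv
  have hwL := HM.isLip (by linarith) hw
  have hC := normConst_pos d
  have hk : Summable fun h => wt p v h * (latNorm (k - h) * ‖w (k - h)‖) :=
    summable_mul_of_sq (HM.summable hv) ((Equiv.summable_iff (f := fun h => (latNorm h * ‖w h‖) ^ 2)
      (Equiv.subLeft k)).2 (by
        have := HM.summable (HM.mono (q := 1) (by linarith) hw)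
        simpa only [wt, Real.rpow_one] using this))
  have hk2 : Summable fun h => wt (p + 1) w h * (latNorm (k - h) * ‖v (k - h)‖) :=
    summable_mul_of_sq (HM.summable hw) ((Equiv.summable_iff (f := fun h => (latNorm h * ‖v h‖) ^ 2)
      (Equiv.subLeft k)).2 (by
        have := HM.summable (HM.mono (q := 1) (by linarith) hv)
        simpa only [wt, Real.rpow_one] using this))
  have he (g : (Fin d → ℤ) → ℝ) : ∑' h, g h = ∑' h, g (k - h) :=
    ((Equiv.subLeft k).tsum_eq g).symm
  have hk2' : Summable fun h => wt (p + 1) w (k - h) * (latNorm h * ‖v h‖) := by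
    have := ((Equiv.subLeft k).summable_iff).2 hk2
    simpa only [Function.comp_def, Equiv.subLeft_apply, sub_sub_cancel] using this
  rw [he (fun h => wt (p + 1) w h * (latNorm (k - h) * ‖v (k - h)‖))]
  simp only [sub_sub_cancel]
  rw [← hk.tsum_add hk2', wt]
  calc latNorm k ^ p * ‖bilin v w k‖
      ≤ latNorm k ^ p *
          (2 * normConst d * ∑' h, ‖v h‖ * (latNorm (k - h) * ‖w (k - h)‖)) := by
        gcongr
        · exact Real.rpow_nonneg (latNorm_nonneg k) p
        · exact norm_bilin_le hvL hwL k
    _ = 2 * normConst d *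
          ∑' h, latNorm k ^ p * (‖v h‖ * (latNorm (k - h) * ‖w (k - h)‖)) := by
        rw [tsum_mul_left]; ring
    _ ≤ 2 * normConst d * ∑' h, 2 ^ p * (wt p v h * (latNorm (k - h) * ‖w (k - h)‖)
          + wt (p + 1) w (k - h) * (latNorm h * ‖v h‖)) := by
        refine mul_le_mul_of_nonneg_left (Summable.tsum_le_tsum (fun h => ?_)
          ((summable_conv hvL hwL k).mul_left _) ((hk.add hk2').mul_left _)) (by positivity)
        have hkl : latNorm k ≤ latNorm h + latNorm (k - h) := by
          simpa using latNorm_add_le h (k - h)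
        have hX : 0 ≤ latNorm (k - h) * ‖w (k - h)‖ :=
          mul_nonneg (latNorm_nonneg _) (norm_nonneg _)
        calc latNorm k ^ p * (‖v h‖ * (latNorm (k - h) * ‖w (k - h)‖))
            ≤ 2 ^ p * (latNorm h ^ p + latNorm (k - h) ^ p)
                * (‖v h‖ * (latNorm (k - h) * ‖w (k - h)‖)) :=
              mul_le_mul_of_nonneg_right (rpow_le_of_le_add (latNorm_nonneg _)
                (latNorm_nonneg _) (latNorm_nonneg _) hp0 hkl)
                (mul_nonneg (norm_nonneg _) hX)
          _ = 2 ^ p * (wt p v h * (latNorm (k - h) * ‖w (k - h)‖)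
                + wt (p + 1) w (k - h) * ‖v h‖) := by
              rw [← one_wt hp0, wt]; ring
          _ ≤ _ := by
              gcongr
              · exact wt_nonneg _ _ _
              · exact norm_le_latNorm_mul (HM.map_zero hv) h
    _ = _ := by rw [tsum_mul_left]; ring

/-- The square root of the sum stands for `hnorm p (bilin v w)`: that `P(v, w)` has zero mean, on
which `hnorm_eq` depends, is shown later. -/
theorem hnorm_bilin_aux {p : ℝ} (hp : (d : ℝ) / 2 + 1 < p) {v w : Coeffs d}
    (hv : v ∈ HM d p) (hw : w ∈ HM d (p + 1)) :
    (Summable fun k => wt p (bilin v w) k ^ 2) ∧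
      √(∑' k, wt p (bilin v w) k ^ 2)
        ≤ 4 * normConst d * 2 ^ p * embedConst d p * (hnorm p v * hnorm (p + 1) w) := by
  have hC := normConst_pos d
  have hw' : w ∈ HM d p := HM.mono (by linarith) hw
  obtain ⟨hv1, hv2⟩ := HM.summable_one hp hv
  obtain ⟨hw1, hw2⟩ := HM.summable_one hp hw'
  have hnn (u : Coeffs d) (k : Fin d → ℤ) : 0 ≤ latNorm k * ‖u k‖ :=
    mul_nonneg (latNorm_nonneg _) (norm_nonneg _)
  obtain ⟨hX, hX'⟩ := sq_conv_le (wt_nonneg p v) (hnn w) (HM.summable hv) hw1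
  obtain ⟨hY, hY'⟩ := sq_conv_le (wt_nonneg (p + 1) w) (hnn v) (HM.summable hw) hv1
  set X := fun k => ∑' h, wt p v h * (latNorm (k - h) * ‖w (k - h)‖)
  set Y := fun k => ∑' h, wt (p + 1) w h * (latNorm (k - h) * ‖v (k - h)‖)
  set K := 2 * normConst d * 2 ^ p with hK
  have hK0 : 0 ≤ K := by positivity
  have hle (k : Fin d → ℤ) : wt p (bilin v w) k ^ 2 ≤ 2 * K ^ 2 * (X k ^ 2 + Y k ^ 2) := by
    calc wt p (bilin v w) k ^ 2 ≤ (K * (X k + Y k)) ^ 2 :=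
          pow_le_pow_left₀ (wt_nonneg _ _ _) (wt_bilin_le hp hv hw k) 2
      _ = K ^ 2 * (X k + Y k) ^ 2 := by ring
      _ ≤ K ^ 2 * (2 * (X k ^ 2 + Y k ^ 2)) := by gcongr; exact add_sq_le
      _ = _ := by ring
  have hs2 := (hX.add hY).mul_left (2 * K ^ 2)
  have hs := Summable.of_nonneg_of_le (fun k => sq_nonneg _) hle hs2
  refine ⟨hs, Real.sqrt_le_iff.2 ⟨?_, ?_⟩⟩
  · have := embedConst_nonneg d p
    have := hnorm_nonneg p v
    have := hnorm_nonneg (p + 1) w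
    positivity
  have hsq (q : ℝ) (u : Coeffs d) (hu : u ∈ HM d q) : ∑' k, wt q u k ^ 2 = hnorm q u ^ 2 := by
    rw [hnorm_eq (HM.map_zero hu), Real.sq_sqrt (tsum_nonneg fun k => sq_nonneg _)]
  have hwn : hnorm p w ≤ hnorm (p + 1) w := hnorm_mono (by linarith) hw
  have hE := embedConst_nonneg d p
  have hv0 := hnorm_nonneg p v
  have hw0 := hnorm_nonneg p w
  calc ∑' k, wt p (bilin v w) k ^ 2
      ≤ 2 * K ^ 2 * (∑' k, X k ^ 2 + ∑' k, Y k ^ 2) := by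
        rw [← hX.tsum_add hY, ← tsum_mul_left]
        exact hs.tsum_le_tsum hle hs2
    _ ≤ 2 * K ^ 2 * ((embedConst d p * hnorm (p + 1) w) ^ 2 * hnorm p v ^ 2
          + (embedConst d p * hnorm p v) ^ 2 * hnorm (p + 1) w ^ 2) := by
        rw [hsq p v hv] at hX'
        rw [hsq (p + 1) w hw] at hY'
        have h1 : ∑' k, latNorm k * ‖w k‖ ≤ embedConst d p * hnorm (p + 1) w :=
          hw2.trans (by gcongr)
        have h3 : 0 ≤ ∑' k, latNorm k * ‖w k‖ := tsum_nonneg (hnn w)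
        have h4 : 0 ≤ ∑' k, latNorm k * ‖v k‖ := tsum_nonneg (hnn v)
        gcongr
        · exact hX'.trans (by gcongr)
        · exact hY'.trans (by gcongr)
    _ = _ := by rw [hK]; ring

theorem advect_conj {v w : Coeffs d} (hv : ∀ k r, v (-k) r = (starRingEnd ℂ) (v k r))
    (hw : ∀ k r, w (-k) r = (starRingEnd ℂ) (w k r)) (k : Fin d → ℤ) (r : Fin d) :
    advect v w (-k) r = (starRingEnd ℂ) (advect v w k r) := by
  simp only [advect, mulCoeffs, partialDeriv, map_sum, map_mul, Complex.conj_ofReal,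
    Complex.conj_tsum]
  refine Finset.sum_congr rfl fun s _ => ?_
  congr 1
  rw [← (Equiv.neg _).tsum_eq]
  refine tsum_congr fun h => ?_
  have : -k - -h = -(k - h) := by abel
  simp only [Equiv.neg_apply, this, hv, hw, Complex.conj_I, Pi.neg_apply]
  simp
  ring

theorem bilin_conj {v w : Coeffs d} (hv : ∀ k r, v (-k) r = (starRingEnd ℂ) (v k r))
    (hw : ∀ k r, w (-k) r = (starRingEnd ℂ) (w k r)) (k : Fin d → ℤ) (r : Fin d) :
    bilin v w (-k) r = (starRingEnd ℂ) (bilin v w k r) := by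
  have ha := advect_conj hv hw k
  have hdot : latDot (-k) (advect v w (-k)) = -(starRingEnd ℂ) (latDot k (advect v w k)) := by
    simp only [latDot, ha, map_sum, map_mul, Pi.neg_apply]
    simp
  simp only [bilin, leray, Pi.neg_apply, PiLp.neg_apply, map_neg, map_sub, map_div₀, map_mul,
    hdot, ha, latNorm_neg, Complex.conj_ofReal]
  simp

/-- `P(v, w)` has zero mean, since `v` is divergence free. -/
theorem bilin_zero {v w : Coeffs d} (hv : IsLip v) (hw : IsLip w)
    (hdiv : ∀ k, latDot k (v k) = 0) : bilin v w 0 = 0 := by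
  have h0 (h : Fin d → ℤ) : advTerm v w 0 h = 0 := by
    have : latDot (0 - h) (v h) = 0 := by
      have := latDot_add_left (0 - h) h (v h)
      rw [hdiv h, sub_add_cancel, add_zero] at this
      rw [← this]; simp [latDot]
    rw [advTerm, this, mul_zero, zero_smul]
  rw [bilin, Pi.neg_apply, leray_apply, advect_eq hv hw]
  simp [h0, latDot]

/-- A field of finite Sobolev norm of nonnegative order has bounded coefficients. -/
theorem growth_of_summable {p : ℝ} (hp : 0 ≤ p) {v : Coeffs d} (h0 : v 0 = 0)
    (hs : Summable fun k => wt p v k ^ 2) :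
    ∃ (C : ℝ) (N : ℕ), ∀ k, ‖v k‖ ≤ C * (1 + latNorm k) ^ N := by
  refine ⟨√(∑' k, wt p v k ^ 2), 0, fun k => ?_⟩
  rw [pow_zero, mul_one]
  have h1 : ‖v k‖ ≤ wt p v k := by simpa [wt] using wt_mono hp h0 k
  exact h1.trans (Real.le_sqrt_of_sq_le (hs.le_tsum k fun _ _ => sq_nonneg _))

theorem bilin_mem {p : ℝ} (hp : (d : ℝ) / 2 + 1 < p) {v w : Coeffs d} (hv : v ∈ HM d p)
    (hw : w ∈ HM d (p + 1)) : bilin v w ∈ HM d p := by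
  have hp0 : 0 ≤ p := by have : (0 : ℝ) ≤ d := Nat.cast_nonneg d; linarith
  have h0 := bilin_zero (HM.isLip hp hv) (HM.isLip (by linarith) hw) hv.2.1
  have hs := (hnorm_bilin_aux hp hv hw).1
  refine HM.mk ⟨bilin_conj hv.1.1 hw.1.1, growth_of_summable hp0 h0 hs⟩ (fun k => ?_) h0 hs
  have : bilin v w k = (-1 : ℂ) • leray (advect v w) k := by simp [bilin]
  rw [this, latDot_smul, latDot_leray, mul_zero]

/-- The basic estimate for fields. -/
theorem hnorm_bilin_le {p : ℝ} (hp : (d : ℝ) / 2 + 1 < p) {v w : Coeffs d}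
    (hv : v ∈ HM d p) (hw : w ∈ HM d (p + 1)) :
    hnorm p (bilin v w)
      ≤ 4 * normConst d * 2 ^ p * embedConst d p * (hnorm p v * hnorm (p + 1) w) := by
  rw [hnorm_eq (HM.map_zero (bilin_mem hp hv hw))]
  exact (hnorm_bilin_aux hp hv hw).2

/-! ### The tame Kato estimate for fields -/

/-- The summand, for the modes `h` of `v` and `l` of `w`, of the trilinear form
`⟨v • ∂w | z⟩`, up to weights and normalization. -/
def triTerm (v w z : Coeffs d) (x : (Fin d → ℤ) × (Fin d → ℤ)) : ℝ :=
  (inner ℂ ((Complex.I * latDot x.2 (v x.1)) • w x.2) (z (x.1 + x.2))).re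

theorem abs_triTerm_le (v w z : Coeffs d) (x : (Fin d → ℤ) × (Fin d → ℤ)) :
    |triTerm v w z x| ≤ ‖latDot x.2 (v x.1)‖ * (‖w x.2‖ * ‖z (x.1 + x.2)‖) := by
  refine (Complex.abs_re_le_norm _).trans ((norm_inner_le_norm _ _).trans_eq ?_)
  rw [norm_smul, norm_mul, Complex.norm_I, one_mul, mul_assoc]

/-- The trilinear form is dominated with all the derivatives distributed over the factors. -/
theorem weight_triTerm_le {p : ℝ} (hp : 0 ≤ p) {v : Coeffs d} (h0 : v 0 = 0) (w z : Coeffs d)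
    (x : (Fin d → ℤ) × (Fin d → ℤ)) :
    |latNorm (x.1 + x.2) ^ (2 * p) * triTerm v w z x|
      ≤ 2 ^ p * (wt p z (x.1 + x.2) * (wt p v x.1 * (latNorm x.2 * ‖w x.2‖))
        + wt p z (x.1 + x.2) * ((latNorm x.1 * ‖v x.1‖) * wt (p + 1) w x.2)) := by
  obtain ⟨h, l⟩ := x
  simp only
  have hk := Real.rpow_nonneg (latNorm_nonneg (h + l)) p
  have hl := latNorm_nonneg l
  have hh := Real.rpow_nonneg (latNorm_nonneg h) p
  have hl' := Real.rpow_nonneg hl p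
  have hv := norm_le_latNorm_mul h0 h
  rw [abs_mul, abs_of_nonneg (Real.rpow_nonneg (latNorm_nonneg _) _), latNorm_rpow_two_mul]
  calc (latNorm (h + l) ^ p) ^ 2 * |triTerm v w z (h, l)|
      ≤ (latNorm (h + l) ^ p) ^ 2 * ((latNorm l * ‖v h‖) * (‖w l‖ * ‖z (h + l)‖)) := by
        gcongr
        refine (abs_triTerm_le _ _ _ _).trans ?_
        gcongr
        exact norm_latDot_le _ _
    _ = latNorm (h + l) ^ p *
          (wt p z (h + l) * (‖v h‖ * (latNorm l * ‖w l‖))) := by rw [wt]; ring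
    _ ≤ 2 ^ p * (latNorm h ^ p + latNorm l ^ p) *
          (wt p z (h + l) * (‖v h‖ * (latNorm l * ‖w l‖))) := by
        have := wt_nonneg p z (h + l)
        exact mul_le_mul_of_nonneg_right (rpow_le_of_le_add (latNorm_nonneg _)
          (latNorm_nonneg _) hl hp (latNorm_add_le h l)) (by positivity)
    _ = 2 ^ p * (wt p z (h + l) * (wt p v h * (latNorm l * ‖w l‖))
          + wt p z (h + l) * (‖v h‖ * wt (p + 1) w l)) := by
        rw [← one_wt hp w l, wt, wt]; ring
    _ ≤ _ := by
        have := wt_nonneg p z (h + l)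
        have := wt_nonneg (p + 1) w l
        gcongr

theorem sqrt_tsum_wt {q : ℝ} {u : Coeffs d} (hu : u ∈ HM d q) :
    √(∑' k, wt q u k ^ 2) = hnorm q u := (hnorm_eq (HM.map_zero hu)).symm

theorem one_mul_nonneg (v : Coeffs d) (k : Fin d → ℤ) : 0 ≤ latNorm k * ‖v k‖ :=
  mul_nonneg (latNorm_nonneg _) (norm_nonneg _)

theorem summable_triTerm {p : ℝ} (hp : (d : ℝ) / 2 + 1 < p) {v w z : Coeffs d}
    (hv : v ∈ HM d p) (hw : w ∈ HM d (p + 1)) (hz : z ∈ HM d p) :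
    Summable fun x : (Fin d → ℤ) × (Fin d → ℤ) =>
      latNorm (x.1 + x.2) ^ (2 * p) * triTerm v w z x := by
  have hp0 : 0 ≤ p := by have : (0 : ℝ) ≤ d := Nat.cast_nonneg d; linarith
  have hw' : w ∈ HM d p := HM.mono (by linarith) hw
  have h1 := (summable_tri_right (wt_nonneg p z) (wt_nonneg p v) (one_mul_nonneg w)
    (HM.summable hz) (HM.summable hv) (HM.summable_one hp hw').1).1
  have h2 := (summable_tri_left (wt_nonneg p z) (one_mul_nonneg v) (wt_nonneg (p + 1) w)
    (HM.summable hz) (HM.summable_one hp hv).1 (HM.summable hw)).1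
  exact Summable.of_norm_bounded ((h1.add h2).mul_left (2 ^ p))
    (weight_triTerm_le hp0 (HM.map_zero hv) w z)

/-- The trilinear form `⟨P(v, w) | z⟩_p` as a double sum over modes; the Leray projection
disappears since `z` is divergence free. -/
theorem hinner_bilin {p : ℝ} (hp : (d : ℝ) / 2 + 1 < p) {v w z : Coeffs d}
    (hv : v ∈ HM d p) (hw : w ∈ HM d (p + 1)) (hz : z ∈ HM d p) :
    hinner p (bilin v w) z = -(normConst d *
      ∑' x : (Fin d → ℤ) × (Fin d → ℤ), latNorm (x.1 + x.2) ^ (2 * p) * triTerm v w z x) := by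
  have hvL := HM.isLip hp hv
  have hwL : IsLip w := HM.isLip (n := p + 1) (by linarith) hw
  let e : (Fin d → ℤ) × (Fin d → ℤ) ≃ (Fin d → ℤ) × (Fin d → ℤ) :=
    { toFun := fun x => (x.2, x.1 - x.2)
      invFun := fun x => (x.1 + x.2, x.1)
      left_inv := fun x => by simp
      right_inv := fun x => by simp }
  have hS := (e.summable_iff).2 (summable_triTerm hp hv hw hz)
  simp only [Function.comp_def] at hS
  have hterm (k : Fin d → ℤ) : (inner ℂ (bilin v w k) (z k)).re
      = -(normConst d * ∑' h, triTerm v w z (h, k - h)) := by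
    have h1 : inner ℂ (bilin v w k) (z k) = -inner ℂ (advect v w k) (z k) := by
      rw [bilin, Pi.neg_apply, inner_neg_left, inner_leray _ _ (HM.latDot_eq hz k)]
    have h2 : HasSum (fun h => (inner ℂ (z k) (advTerm v w k h)).re)
        (inner ℂ (z k) (∑' h, advTerm v w k h)).re :=
      Complex.hasSum_re ((innerSL ℂ (z k)).hasSum (summable_advTerm hvL hwL k).hasSum)
    have h3 (a b : EuclideanSpace ℂ (Fin d)) : (inner ℂ a b).re = (inner ℂ b a).re :=
      inner_re_symm (𝕜 := ℂ) a b
    rw [h1, advect_eq hvL hwL, inner_smul_left, Complex.conj_ofReal, Complex.neg_re,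
      Complex.re_ofReal_mul, h3, ← h2.tsum_eq]
    congr 2
    refine tsum_congr fun h => ?_
    rw [h3, triTerm, advTerm]
    simp only [add_sub_cancel]
  rw [hinner_eq_tsum (HM.map_zero hz), ← e.tsum_eq, ← tsum_mul_left, ← tsum_neg,
    (((hS.mul_left (normConst d))).neg).tsum_prod]
  refine tsum_congr fun k => ?_
  rw [hterm, ← neg_mul, mul_left_comm, ← tsum_mul_left, ← tsum_mul_left]
  refine tsum_congr fun h => ?_
  simp [e]

/-- Since `v` is real and divergence free, exchanging the roles of the modes of `w` and `z`
changes the sign of the trilinear form. -/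
theorem triTerm_swap {v w z : Coeffs d} (hv : ∀ k r, v (-k) r = (starRingEnd ℂ) (v k r))
    (hdiv : ∀ k, latDot k (v k) = 0) (h l : Fin d → ℤ) :
    triTerm v z w (-h, h + l) = -triTerm v w z (h, l) := by
  have h1 : latDot (h + l) (v (-h)) = (starRingEnd ℂ) (latDot l (v h)) := by
    have : latDot l (v h) = latDot (h + l) (v h) := by
      rw [latDot_add_left, hdiv, zero_add]
    rw [this]
    simp only [latDot, hv, map_sum, map_mul, map_intCast]
  simp only [triTerm, neg_add_cancel_left, h1, inner_smul_left, map_mul, Complex.conj_I,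
    Complex.conj_conj]
  rw [← inner_conj_symm (w l) (z (h + l))]
  simp only [Complex.mul_re, Complex.mul_im, Complex.neg_re, Complex.neg_im, Complex.I_re,
    Complex.I_im, Complex.conj_re, Complex.conj_im]
  ring

/-- The derivative in `v • ∂w` can be counted at the frequency of `w` or at the output frequency,
as `v` is divergence free. -/
theorem abs_triTerm_le_min {v : Coeffs d} (hdiv : ∀ k, latDot k (v k) = 0) (w z : Coeffs d)
    (h l : Fin d → ℤ) :
    |triTerm v w z (h, l)|
      ≤ min (latNorm (h + l)) (latNorm l) * (‖v h‖ * (‖w l‖ * ‖z (h + l)‖)) := by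
  refine (abs_triTerm_le _ _ _ _).trans ?_
  rw [← mul_assoc (min _ _)]
  refine mul_le_mul_of_nonneg_right ?_ (by positivity)
  rw [min_mul_of_nonneg _ _ (norm_nonneg _)]
  refine le_min ?_ (norm_latDot_le _ _)
  have : latDot l (v h) = latDot (h + l) (v h) := by rw [latDot_add_left, hdiv, zero_add]
  rw [this]
  exact norm_latDot_le _ _

/-- The constant in the symmetrized Kato estimate for fields. -/
def katoConst (d : ℕ) (p n : ℝ) : ℝ := normConst d * (p * 2 ^ p * embedConst d n)

/-- The tame Kato estimate for the symmetrized trilinear form. -/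
theorem kato_symm {n p : ℝ} (hn : (d : ℝ) / 2 + 1 < n) (hnp : n ≤ p) {v w z : Coeffs d}
    (hv : v ∈ HM d p) (hw : w ∈ HM d (p + 1)) (hz : z ∈ HM d (p + 1)) :
    |hinner p (bilin v w) z + hinner p (bilin v z) w| ≤ katoConst d p n *
      (hnorm n v * (hnorm p w * hnorm p z) + hnorm p v * (hnorm n w * hnorm p z)
        + hnorm p v * (hnorm p w * hnorm n z)) := by
  have hp : (d : ℝ) / 2 + 1 < p := hn.trans_le hnp
  have hp1 : 1 ≤ p := by have : (0 : ℝ) ≤ d := Nat.cast_nonneg d; linarith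
  have hw' : w ∈ HM d p := HM.mono (by linarith) hw
  have hz' : z ∈ HM d p := HM.mono (by linarith) hz
  have hC := normConst_pos d
  -- the involution of the pairs of modes that exchanges `l` and `k = h + l`
  let e : (Fin d → ℤ) × (Fin d → ℤ) ≃ (Fin d → ℤ) × (Fin d → ℤ) :=
    { toFun := fun x => (-x.1, x.1 + x.2)
      invFun := fun x => (-x.1, x.1 + x.2)
      left_inv := fun x => by simp
      right_inv := fun x => by simp }
  have hS1 := summable_triTerm hp hv hw hz'
  have hS2 := (e.summable_iff).2 (summable_triTerm hp hv hz hw')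
  simp only [Function.comp_def] at hS2
  -- the commutator form of the symmetrized trilinear expression
  have hsum : hinner p (bilin v w) z + hinner p (bilin v z) w = -(normConst d *
      ∑' x : (Fin d → ℤ) × (Fin d → ℤ),
        (latNorm (x.1 + x.2) ^ (2 * p) - latNorm x.2 ^ (2 * p)) * triTerm v w z x) := by
    rw [hinner_bilin hp hv hw hz', hinner_bilin hp hv hz hw', ← neg_add, ← mul_add, ← e.tsum_eq
      (fun x => latNorm (x.1 + x.2) ^ (2 * p) * triTerm v z w x), ← hS1.tsum_add hS2]
    congr 2
    refine tsum_congr fun x => ?_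
    simp only [e, Equiv.coe_fn_mk, neg_add_cancel_left]
    rw [triTerm_swap hv.1.1 hv.2.1]
    ring
  obtain ⟨a1, a2⟩ := HM.summable_one hn (HM.mono hnp hv)
  obtain ⟨b1, b2⟩ := HM.summable_one hn (HM.mono hnp hw')
  obtain ⟨c1, c2⟩ := HM.summable_one hn (HM.mono hnp hz')
  obtain ⟨s1, t1⟩ := summable_tri_left (wt_nonneg p z) (one_mul_nonneg v) (wt_nonneg p w)
    (HM.summable hz') a1 (HM.summable hw')
  obtain ⟨s2, t2⟩ := summable_tri_right (wt_nonneg p z) (wt_nonneg p v) (one_mul_nonneg w)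
    (HM.summable hz') (HM.summable hv) b1
  obtain ⟨s3, t3⟩ := summable_tri_sum (one_mul_nonneg z) (wt_nonneg p v) (wt_nonneg p w)
    c1 (HM.summable hv) (HM.summable hw')
  rw [sqrt_tsum_wt hz', sqrt_tsum_wt hw'] at t1
  rw [sqrt_tsum_wt hz', sqrt_tsum_wt hv] at t2
  rw [sqrt_tsum_wt hv, sqrt_tsum_wt hw'] at t3
  have hle (x : (Fin d → ℤ) × (Fin d → ℤ)) :
      ‖(latNorm (x.1 + x.2) ^ (2 * p) - latNorm x.2 ^ (2 * p)) * triTerm v w z x‖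
      ≤ p * 2 ^ p * (wt p z (x.1 + x.2) * ((latNorm x.1 * ‖v x.1‖) * wt p w x.2)
        + wt p z (x.1 + x.2) * (wt p v x.1 * (latNorm x.2 * ‖w x.2‖))
        + (latNorm (x.1 + x.2) * ‖z (x.1 + x.2)‖) * (wt p v x.1 * wt p w x.2)) := by
    obtain ⟨h, l⟩ := x
    simp only
    rw [Real.norm_eq_abs, abs_mul]
    have hba : latNorm l ≤ latNorm (h + l) + latNorm h := by
      have := latNorm_add_le (h + l) (-h)
      rwa [latNorm_neg, add_neg_cancel_comm] at this
    have hkw := kato_weight (latNorm_nonneg (h + l)) (latNorm_nonneg l) (latNorm_nonneg h)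
      ((latNorm_add_le h l).trans_eq (add_comm _ _)) hba hp1
    calc _ ≤ |latNorm (h + l) ^ (2 * p) - latNorm l ^ (2 * p)| *
          (min (latNorm (h + l)) (latNorm l) * (‖v h‖ * (‖w l‖ * ‖z (h + l)‖))) := by
          gcongr
          exact abs_triTerm_le_min hv.2.1 w z h l
      _ = (|latNorm (h + l) ^ (2 * p) - latNorm l ^ (2 * p)| *
          min (latNorm (h + l)) (latNorm l)) * (‖v h‖ * (‖w l‖ * ‖z (h + l)‖)) := by ring
      _ ≤ _ * (‖v h‖ * (‖w l‖ * ‖z (h + l)‖)) :=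
          mul_le_mul_of_nonneg_right hkw (by positivity)
      _ = _ := by simp only [wt]; ring
  have hbd := tsum_of_norm_bounded (((s1.add s2).add s3).mul_left (p * 2 ^ p)).hasSum hle
  rw [tsum_mul_left, (s1.add s2).tsum_add s3, s1.tsum_add s2, Real.norm_eq_abs] at hbd
  have hvp := hnorm_nonneg p v
  have hwp := hnorm_nonneg p w
  have hzp := hnorm_nonneg p z
  rw [hsum, abs_neg, abs_mul, abs_of_pos hC, katoConst, mul_assoc]
  refine mul_le_mul_of_nonneg_left (hbd.trans ?_) hC.le
  rw [mul_assoc (p * 2 ^ p)]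
  refine mul_le_mul_of_nonneg_left ?_ (by positivity)
  calc _ ≤ hnorm p z * ((embedConst d n * hnorm n v) * hnorm p w)
        + hnorm p z * (hnorm p v * (embedConst d n * hnorm n w))
        + (embedConst d n * hnorm n z) * (hnorm p v * hnorm p w) := by
        refine add_le_add (add_le_add (t1.trans ?_) (t2.trans ?_)) (t3.trans ?_) <;> gcongr
    _ = _ := by ring

/-! ### The Sobolev spaces as subspaces of a Hilbert space -/

theorem IsDistribution.add {v w : Coeffs d} (hv : IsDistribution v) (hw : IsDistribution w) :
    IsDistribution (v + w) := by
  obtain ⟨hv1, C, N, hC⟩ := hv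
  obtain ⟨hw1, C', N', hC'⟩ := hw
  refine ⟨fun k r => by simp [hv1, hw1], |C| + |C'|, N + N', fun k => ?_⟩
  have h1 : 1 ≤ 1 + latNorm k := by linarith [latNorm_nonneg k]
  have hN : (1 + latNorm k) ^ N ≤ (1 + latNorm k) ^ (N + N') :=
    pow_le_pow_right₀ h1 (Nat.le_add_right _ _)
  have hN' : (1 + latNorm k) ^ N' ≤ (1 + latNorm k) ^ (N + N') :=
    pow_le_pow_right₀ h1 (Nat.le_add_left _ _)
  calc ‖(v + w) k‖ ≤ ‖v k‖ + ‖w k‖ := norm_add_le _ _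
    _ ≤ |C| * (1 + latNorm k) ^ N + |C'| * (1 + latNorm k) ^ N' :=
        add_le_add ((hC k).trans (by gcongr; exact le_abs_self _))
          ((hC' k).trans (by gcongr; exact le_abs_self _))
    _ ≤ |C| * (1 + latNorm k) ^ (N + N') + |C'| * (1 + latNorm k) ^ (N + N') := by gcongr
    _ = _ := by ring

theorem IsDistribution.smul {v : Coeffs d} (hv : IsDistribution v) (c : ℝ) :
    IsDistribution (c • v) := by
  obtain ⟨hv1, C, N, hC⟩ := hv
  refine ⟨fun k r => by simp [hv1], |c| * C, N, fun k => ?_⟩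
  rw [Pi.smul_apply, norm_smul, Real.norm_eq_abs, mul_assoc]
  exact mul_le_mul_of_nonneg_left (hC k) (abs_nonneg _)

theorem wt_smul (p c : ℝ) (v : Coeffs d) (k : Fin d → ℤ) : wt p (c • v) k = |c| * wt p v k := by
  rw [wt, wt, Pi.smul_apply, norm_smul, Real.norm_eq_abs]; ring

theorem wt_add_le (p : ℝ) (v w : Coeffs d) (k : Fin d → ℤ) :
    wt p (v + w) k ≤ wt p v k + wt p w k := by
  rw [wt, wt, wt, ← mul_add]
  exact mul_le_mul_of_nonneg_left (norm_add_le _ _) (Real.rpow_nonneg (latNorm_nonneg k) p)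

/-- The Sobolev space of order `p` of fields, as a real vector space. -/
def sobolev (d : ℕ) (p : ℝ) : Submodule ℝ (Coeffs d) where
  carrier := HM d p
  zero_mem' := HM.mk ⟨fun k r => by simp, 0, 0, fun k => by simp⟩ (fun k => by simp [latDot]) rfl
    (by simp [wt])
  add_mem' := by
    intro v w hv hw
    refine HM.mk (hv.1.add hw.1) (fun k => ?_) ?_ ?_
    · rw [Pi.add_apply, latDot_add, HM.latDot_eq hv, HM.latDot_eq hw, add_zero]
    · rw [Pi.add_apply, HM.map_zero hv, HM.map_zero hw, add_zero]
    · refine Summable.of_nonneg_of_le (fun k => sq_nonneg _) (fun k => ?_)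
        (((HM.summable hv).add (HM.summable hw)).mul_left 2)
      exact (pow_le_pow_left₀ (wt_nonneg _ _ _) (wt_add_le p v w k) 2).trans add_sq_le
  smul_mem' := by
    intro c v hv
    refine HM.mk (hv.1.smul c) (fun k => ?_) ?_ ?_
    · have : (c • v) k = (c : ℂ) • v k := by ext r; simp
      rw [this, latDot_smul, HM.latDot_eq hv, mul_zero]
    · rw [Pi.smul_apply, HM.map_zero hv, smul_zero]
    · simp only [wt_smul, mul_pow]
      exact (HM.summable hv).mul_left _

/-- The Sobolev space of order `p` of pairs of fields, as a real vector space. -/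
def sobolevPair (d : ℕ) (p : ℝ) : Submodule ℝ (Pair d) := (sobolev d p).prod (sobolev d p)

theorem HD_add {p : ℝ} {v w : Pair d} (hv : v ∈ HD d p) (hw : w ∈ HD d p) : v + w ∈ HD d p :=
  (sobolevPair d p).add_mem hv hw

theorem HD_sub {p : ℝ} {v w : Pair d} (hv : v ∈ HD d p) (hw : w ∈ HD d p) : v - w ∈ HD d p :=
  (sobolevPair d p).sub_mem hv hw

theorem HD_smul {p : ℝ} {v : Pair d} (hv : v ∈ HD d p) (c : ℝ) : c • v ∈ HD d p :=
  (sobolevPair d p).smul_mem c hv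

/-- The Hilbert space of square summable families of pairs of vectors of `ℂ^d`. -/
def PairSeq (d : ℕ) : Type :=
  lp (fun _ : Fin d → ℤ => WithLp 2 (EuclideanSpace ℂ (Fin d) × EuclideanSpace ℂ (Fin d))) 2

instance : NormedAddCommGroup (PairSeq d) := inferInstanceAs (NormedAddCommGroup
  (lp (fun _ : Fin d → ℤ => WithLp 2 (EuclideanSpace ℂ (Fin d) × EuclideanSpace ℂ (Fin d))) 2))

instance : InnerProductSpace ℂ (PairSeq d) := inferInstanceAs (InnerProductSpace ℂ
  (lp (fun _ : Fin d → ℤ => WithLp 2 (EuclideanSpace ℂ (Fin d) × EuclideanSpace ℂ (Fin d))) 2))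

/-- The real part of the complex inner product; `PairSeq` is not reducible, so that no other real
inner product can be found for it. -/
instance : InnerProductSpace ℝ (PairSeq d) := InnerProductSpace.complexToReal

/-- The weighted coefficients `|k|^q (v_k, b_k)` of a pair `(v, b)`. -/
def wtPair (q : ℝ) (v : Pair d) (k : Fin d → ℤ) :
    WithLp 2 (EuclideanSpace ℂ (Fin d) × EuclideanSpace ℂ (Fin d)) :=
  WithLp.toLp 2 (((latNorm k ^ q : ℝ) : ℂ) • v.1 k, ((latNorm k ^ q : ℝ) : ℂ) • v.2 k)

theorem norm_wtPair_sq (q : ℝ) (v : Pair d) (k : Fin d → ℤ) :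
    ‖wtPair q v k‖ ^ 2 = wt q v.1 k ^ 2 + wt q v.2 k ^ 2 := by
  have h := Real.rpow_nonneg (latNorm_nonneg k) q
  rw [wtPair, WithLp.prod_norm_sq_eq_of_L2]
  simp [norm_smul, wt, abs_of_nonneg h]

theorem memℓp_wtPair {q : ℝ} {v : Pair d} (hv : v ∈ HD d q) : Memℓp (wtPair q v) 2 := by
  refine memℓp_gen ?_
  simp only [ENNReal.toReal_ofNat, Real.rpow_two, norm_wtPair_sq]
  exact (HM.summable hv.1).add (HM.summable hv.2)

open Classical in
/-- The isometric embedding of the Sobolev space of order `q` of pairs into a Hilbert space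
(with the value `0` outside of the Sobolev space). -/
def emb (q : ℝ) (v : Pair d) : PairSeq d :=
  if h : v ∈ HD d q then ⟨wtPair q v, memℓp_wtPair h⟩ else 0

theorem emb_val {q : ℝ} {v : Pair d} (hv : v ∈ HD d q) :
    (emb q v).1 = wtPair q v := by
  have h : emb q v = ⟨wtPair q v, memℓp_wtPair hv⟩ := dif_pos hv
  rw [h]

theorem emb_add {q : ℝ} {v w : Pair d} (hv : v ∈ HD d q) (hw : w ∈ HD d q) :
    emb q (v + w) = emb q v + emb q w := by
  refine Subtype.ext ?_
  rw [emb_val (HD_add hv hw)]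
  change _ = (emb q v).1 + (emb q w).1
  rw [emb_val hv, emb_val hw]
  funext k
  change wtPair q (v + w) k = wtPair q v k + wtPair q w k
  simp only [wtPair, Prod.fst_add, Prod.snd_add, Pi.add_apply, smul_add]
  rfl

theorem inner_emb {q : ℝ} {v w : Pair d} (hv : v ∈ HD d q) (hw : w ∈ HD d q) :
    inner ℝ (emb q v) (emb q w) = pinner q v w := by
  have h1 : HasSum (fun k => (inner ℂ ((emb q v).1 k) ((emb q w).1 k)).re)
      (inner ℂ (emb q v) (emb q w)).re := Complex.hasSum_re (lp.hasSum_inner (𝕜 := ℂ)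
        (G := fun _ : Fin d → ℤ => WithLp 2 (EuclideanSpace ℂ (Fin d) × EuclideanSpace ℂ (Fin d)))
        (emb q v) (emb q w))
  have h2 (k : Fin d → ℤ) : (inner ℂ ((emb q v).1 k) ((emb q w).1 k)).re
      = latNorm k ^ (2 * q) * (inner ℂ (v.1 k) (w.1 k)).re
        + latNorm k ^ (2 * q) * (inner ℂ (v.2 k) (w.2 k)).re := by
    rw [emb_val hv, emb_val hw, WithLp.prod_inner_apply, latNorm_rpow_two_mul]
    simp only [wtPair, inner_smul_left, inner_smul_right, Complex.conj_ofReal, Complex.add_re,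
      Complex.re_ofReal_mul]
    ring
  have h3 (a b : Coeffs d) (ha : a ∈ HM d q) (hb : b ∈ HM d q) :
      Summable fun k => latNorm k ^ (2 * q) * (inner ℂ (a k) (b k)).re := by
    refine Summable.of_norm_bounded (summable_mul_of_sq (HM.summable ha) (HM.summable hb))
      fun k => ?_
    have h := Real.rpow_nonneg (latNorm_nonneg k) q
    rw [Real.norm_eq_abs, abs_mul, latNorm_rpow_two_mul, abs_of_nonneg (sq_nonneg _)]
    calc _ ≤ (latNorm k ^ q) ^ 2 * (‖a k‖ * ‖b k‖) := by
          gcongr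
          exact (Complex.abs_re_le_norm _).trans (norm_inner_le_norm _ _)
      _ = _ := by rw [wt, wt]; ring
  change (inner ℂ (emb q v) (emb q w)).re = _
  rw [← h1.tsum_eq, tsum_congr h2, (h3 _ _ hv.1 hw.1).tsum_add (h3 _ _ hv.2 hw.2), pinner,
    hinner_eq_tsum (HM.map_zero hw.1), hinner_eq_tsum (HM.map_zero hw.2)]

theorem norm_emb {q : ℝ} {v : Pair d} (hv : v ∈ HD d q) : ‖emb q v‖ = pnorm q v := by
  rw [pnorm, ← inner_emb hv hv, real_inner_self_eq_norm_sq, Real.sqrt_sq (norm_nonneg _)]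

theorem emb_smul {q : ℝ} {v : Pair d} (hv : v ∈ HD d q) (c : ℝ) :
    emb q (c • v) = c • emb q v := by
  refine Subtype.ext ?_
  rw [emb_val (HD_smul hv c)]
  change _ = (c : ℂ) • (emb q v).1
  rw [emb_val hv]
  funext k
  change wtPair q (c • v) k = (c : ℂ) • wtPair q v k
  rw [wtPair, wtPair, ← WithLp.toLp_smul]
  congr 1
  ext r <;> simp <;> ring

theorem emb_sub {q : ℝ} {v w : Pair d} (hv : v ∈ HD d q) (hw : w ∈ HD d q) :
    emb q (v - w) = emb q v - emb q w := by
  rw [eq_sub_iff_add_eq, ← emb_add (HD_sub hv hw) hw, sub_add_cancel]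

theorem emb_ne_zero {q : ℝ} {v : Pair d} (hv : v ∈ HD d q) (h : v ≠ 0) : emb q v ≠ 0 := by
  contrapose! h
  have h1 (k : Fin d → ℤ) : wtPair q v k = 0 := by
    rw [← emb_val hv, h]; rfl
  have h2 (k : Fin d → ℤ) : v.1 k = 0 ∧ v.2 k = 0 := by
    rcases eq_or_ne k 0 with rfl | hk
    · exact ⟨HM.map_zero hv.1, HM.map_zero hv.2⟩
    · have hw : ((latNorm k ^ q : ℝ) : ℂ) ≠ 0 := by
        exact_mod_cast (Real.rpow_pos_of_pos (latNorm_pos hk) q).ne'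
      have h3 := congrArg WithLp.ofLp (h1 k)
      simp only [wtPair, WithLp.ofLp_zero, Prod.mk_eq_zero, smul_eq_zero, hw, false_or] at h3
      exact h3
  exact Prod.ext (funext fun k => (h2 k).1) (funext fun k => (h2 k).2)

theorem pnorm_nonneg (q : ℝ) (v : Pair d) : 0 ≤ pnorm q v := Real.sqrt_nonneg _

theorem pnorm_neg (q : ℝ) (v : Pair d) : pnorm q (-v) = pnorm q v := by
  simp [pnorm, pinner, hinner]

theorem pnorm_sub_le {q : ℝ} {v w : Pair d} (hv : v ∈ HD d q) (hw : w ∈ HD d q) :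
    pnorm q (v - w) ≤ pnorm q v + pnorm q w := by
  rw [← norm_emb hv, ← norm_emb hw, ← norm_emb (HD_sub hv hw), emb_sub hv hw]
  exact norm_sub_le _ _

theorem abs_pinner_le {q : ℝ} {v w : Pair d} (hv : v ∈ HD d q) (hw : w ∈ HD d q) :
    |pinner q v w| ≤ pnorm q v * pnorm q w := by
  rw [← norm_emb hv, ← norm_emb hw, ← inner_emb hv hw]
  exact abs_real_inner_le_norm _ _

theorem pinner_add_left {q : ℝ} {v w z : Pair d} (hv : v ∈ HD d q) (hw : w ∈ HD d q)
    (hz : z ∈ HD d q) : pinner q (v + w) z = pinner q v z + pinner q w z := by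
  rw [← inner_emb hv hz, ← inner_emb hw hz, ← inner_emb (HD_add hv hw) hz, emb_add hv hw,
    inner_add_left]

theorem pinner_sub_left {q : ℝ} {v w z : Pair d} (hv : v ∈ HD d q) (hw : w ∈ HD d q)
    (hz : z ∈ HD d q) : pinner q (v - w) z = pinner q v z - pinner q w z := by
  rw [← inner_emb hv hz, ← inner_emb hw hz, ← inner_emb (HD_sub hv hw) hz, emb_sub hv hw,
    inner_sub_left]

theorem pinner_self {q : ℝ} {v : Pair d} (hv : v ∈ HD d q) : pinner q v v = pnorm q v ^ 2 := by
  rw [← inner_emb hv hv, real_inner_self_eq_norm_sq, norm_emb hv]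

theorem hinner_self_eq_sq {q : ℝ} {v : Coeffs d} (h0 : v 0 = 0) :
    hinner q v v = hnorm q v ^ 2 := by
  rw [hnorm, Real.sq_sqrt]
  rw [hinner_self h0]
  exact tsum_nonneg fun k => sq_nonneg _

theorem pnorm_sq {q : ℝ} {v : Pair d} (hv : v ∈ HD d q) :
    pnorm q v ^ 2 = hnorm q v.1 ^ 2 + hnorm q v.2 ^ 2 := by
  rw [← pinner_self hv, pinner, hinner_self_eq_sq (HM.map_zero hv.1),
    hinner_self_eq_sq (HM.map_zero hv.2)]

theorem hnorm_fst_le {q : ℝ} {v : Pair d} (hv : v ∈ HD d q) : hnorm q v.1 ≤ pnorm q v := by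
  refine le_of_sq_le_sq ?_ (pnorm_nonneg q v)
  rw [pnorm_sq hv]
  linarith [sq_nonneg (hnorm q v.2)]

theorem hnorm_snd_le {q : ℝ} {v : Pair d} (hv : v ∈ HD d q) : hnorm q v.2 ≤ pnorm q v := by
  refine le_of_sq_le_sq ?_ (pnorm_nonneg q v)
  rw [pnorm_sq hv]
  linarith [sq_nonneg (hnorm q v.1)]

theorem pnorm_le_add {q : ℝ} {v : Pair d} (hv : v ∈ HD d q) :
    pnorm q v ≤ hnorm q v.1 + hnorm q v.2 := by
  have h1 := hnorm_nonneg q v.1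
  have h2 := hnorm_nonneg q v.2
  refine le_of_sq_le_sq ?_ (by positivity)
  rw [pnorm_sq hv]
  nlinarith

theorem inl_mem {q : ℝ} {v : Coeffs d} (hv : v ∈ HM d q) : ((v, 0) : Pair d) ∈ HD d q :=
  ⟨hv, (sobolev d q).zero_mem⟩

/-- Facts about pairs specialize to fields through `v ↦ (v, 0)`. -/
theorem hinner_eq_pinner (q : ℝ) (v w : Coeffs d) :
    hinner q v w = pinner q ((v, 0) : Pair d) (w, 0) := by
  simp [pinner, hinner]

theorem hnorm_sub_le {q : ℝ} {v w : Coeffs d} (hv : v ∈ HM d q) (hw : w ∈ HM d q) :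
    hnorm q (v - w) ≤ hnorm q v + hnorm q w := by
  have h := pnorm_sub_le (inl_mem hv) (inl_mem hw)
  simpa only [pnorm, hnorm, hinner_eq_pinner, Prod.mk_sub_mk, sub_zero] using h

theorem hinner_sub_left {q : ℝ} {v w z : Coeffs d} (hv : v ∈ HM d q) (hw : w ∈ HM d q)
    (hz : z ∈ HM d q) : hinner q (v - w) z = hinner q v z - hinner q w z := by
  have h := pinner_sub_left (inl_mem hv) (inl_mem hw) (inl_mem hz)
  simpa only [hinner_eq_pinner, Prod.mk_sub_mk, sub_zero] using h

/-! ### The estimates for the bilinear map of magnetohydrodynamics -/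

theorem HD_mono {p q : ℝ} (hqp : q ≤ p) {v : Pair d} (hv : v ∈ HD d p) : v ∈ HD d q :=
  ⟨HM.mono hqp hv.1, HM.mono hqp hv.2⟩

theorem mhdBilin_mem {p : ℝ} (hp : (d : ℝ) / 2 + 1 < p) {v w : Pair d} (hv : v ∈ HD d p)
    (hw : w ∈ HD d (p + 1)) : mhdBilin v w ∈ HD d p :=
  ⟨(sobolev d p).sub_mem (bilin_mem hp hv.1 hw.1) (bilin_mem hp hv.2 hw.2),
    (sobolev d p).sub_mem (bilin_mem hp hv.1 hw.2) (bilin_mem hp hv.2 hw.1)⟩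

theorem mhdBilin_add_left {p : ℝ} (hp : (d : ℝ) / 2 + 1 < p) {v v' w : Pair d}
    (hv : v ∈ HD d p) (hv' : v' ∈ HD d p) (hw : w ∈ HD d p) :
    mhdBilin (v + v') w = mhdBilin v w + mhdBilin v' w := by
  have hL {x : Coeffs d} (hx : x ∈ HM d p) : IsLip x := HM.isLip hp hx
  simp only [mhdBilin, Prod.fst_add, Prod.snd_add, Prod.mk_add_mk,
    bilin_add_left (hL hv.1) (hL hv'.1) (hL hw.1), bilin_add_left (hL hv.1) (hL hv'.1) (hL hw.2),
    bilin_add_left (hL hv.2) (hL hv'.2) (hL hw.1), bilin_add_left (hL hv.2) (hL hv'.2) (hL hw.2)]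
  congr 1 <;> abel

theorem mhdBilin_add_right {p : ℝ} (hp : (d : ℝ) / 2 + 1 < p) {v w w' : Pair d}
    (hv : v ∈ HD d p) (hw : w ∈ HD d p) (hw' : w' ∈ HD d p) :
    mhdBilin v (w + w') = mhdBilin v w + mhdBilin v w' := by
  have hL {x : Coeffs d} (hx : x ∈ HM d p) : IsLip x := HM.isLip hp hx
  simp only [mhdBilin, Prod.fst_add, Prod.snd_add, Prod.mk_add_mk,
    bilin_add_right (hL hv.1) (hL hw.1) (hL hw'.1), bilin_add_right (hL hv.1) (hL hw.2) (hL hw'.2),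
    bilin_add_right (hL hv.2) (hL hw.1) (hL hw'.1), bilin_add_right (hL hv.2) (hL hw.2) (hL hw'.2)]
  congr 1 <;> abel

theorem exists_basicConstant {p : ℝ} (hp : (d : ℝ) / 2 + 1 < p) :
    ∃ K : ℝ, IsBasicConstant d p p K := by
  set K := 4 * normConst d * 2 ^ p * embedConst d p with hK
  have hK0 : 0 ≤ K := by
    have := normConst_pos d
    have := embedConst_nonneg d p
    positivity
  refine ⟨4 * K + 1, by positivity, fun v hv w hw => ?_⟩
  have hX := pnorm_nonneg p v
  have hY := pnorm_nonneg (p + 1) w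
  have hb {a b : Coeffs d} (ha : a ∈ HM d p) (hb : b ∈ HM d (p + 1))
      (ha' : hnorm p a ≤ pnorm p v) (hb' : hnorm (p + 1) b ≤ pnorm (p + 1) w) :
      hnorm p (bilin a b) ≤ K * (pnorm p v * pnorm (p + 1) w) := by
    refine (hnorm_bilin_le hp ha hb).trans ?_
    have := hnorm_nonneg (p + 1) b
    gcongr
  have h1 := hb hv.1 hw.1 (hnorm_fst_le hv) (hnorm_fst_le hw)
  have h2 := hb hv.2 hw.2 (hnorm_snd_le hv) (hnorm_snd_le hw)
  have h3 := hb hv.1 hw.2 (hnorm_fst_le hv) (hnorm_snd_le hw)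
  have h4 := hb hv.2 hw.1 (hnorm_snd_le hv) (hnorm_fst_le hw)
  have h5 := pnorm_le_add (mhdBilin_mem hp hv hw)
  have h6 := hnorm_sub_le (bilin_mem hp hv.1 hw.1) (bilin_mem hp hv.2 hw.2)
  have h7 := hnorm_sub_le (bilin_mem hp hv.1 hw.2) (bilin_mem hp hv.2 hw.1)
  simp only [mhdBilin] at h5 ⊢
  linarith [mul_nonneg hX hY]

/-- The Kato constants exist: in `⟨P(v, w) | w⟩_p` the terms that are not symmetric in the two
components of `w` combine into symmetrized trilinear forms. -/
theorem exists_katoConstant {n p : ℝ} (hn : (d : ℝ) / 2 + 1 < n) (hnp : n ≤ p) :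
    ∃ G : ℝ, IsKatoConstant d p n G := by
  have hp : (d : ℝ) / 2 + 1 < p := hn.trans_le hnp
  have hp0 : 0 ≤ p := by have : (0 : ℝ) ≤ d := Nat.cast_nonneg d; linarith
  set K := katoConst d p n with hK
  have hK0 : 0 ≤ K := by
    have := normConst_pos d
    have := embedConst_nonneg d n
    rw [hK, katoConst]
    positivity
  refine ⟨8 * K + 1, by positivity, fun v hv w hw => ?_⟩
  have hw' : w ∈ HD d p := HD_mono (by linarith) hw
  set A := pnorm p v
  set A' := pnorm n v
  set B := pnorm p w
  set B' := pnorm n w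
  have hA : 0 ≤ A := pnorm_nonneg _ _
  have hA' : 0 ≤ A' := pnorm_nonneg _ _
  have hB : 0 ≤ B := pnorm_nonneg _ _
  have hB' : 0 ≤ B' := pnorm_nonneg _ _
  have hb {a b c : Coeffs d} (ha : a ∈ HM d p) (hb : b ∈ HM d (p + 1)) (hc : c ∈ HM d (p + 1))
      (a1 : hnorm p a ≤ A) (a2 : hnorm n a ≤ A') (b1 : hnorm p b ≤ B) (b2 : hnorm n b ≤ B')
      (c1 : hnorm p c ≤ B) (c2 : hnorm n c ≤ B') :
      |hinner p (bilin a b) c + hinner p (bilin a c) b|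
        ≤ K * (A' * (B * B) + A * (B' * B) + A * (B * B')) := by
    refine (kato_symm hn hnp ha hb hc).trans ?_
    have := hnorm_nonneg p b
    have := hnorm_nonneg n b
    have := hnorm_nonneg p c
    have := hnorm_nonneg n c
    gcongr
  have v1 := hnorm_fst_le hv
  have v2 := hnorm_snd_le hv
  have v3 := hnorm_fst_le (HD_mono hnp hv)
  have v4 := hnorm_snd_le (HD_mono hnp hv)
  have w1 := hnorm_fst_le hw'
  have w2 := hnorm_snd_le hw'
  have w3 := hnorm_fst_le (HD_mono hnp hw')
  have w4 := hnorm_snd_le (HD_mono hnp hw')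
  have e1 := abs_le.1 (hb hv.1 hw.1 hw.1 v1 v3 w1 w3 w1 w3)
  have e2 := abs_le.1 (hb hv.1 hw.2 hw.2 v1 v3 w2 w4 w2 w4)
  have e3 := abs_le.1 (hb hv.2 hw.2 hw.1 v2 v4 w2 w4 w1 w3)
  have hX : 0 ≤ A * (B' * B) := by positivity
  have hY : 0 ≤ A' * (B * B) := by positivity
  have hKX := mul_nonneg hK0 hX
  have hKY := mul_nonneg hK0 hY
  rw [pinner, mhdBilin]
  simp only
  rw [hinner_sub_left (bilin_mem hp hv.1 hw.1) (bilin_mem hp hv.2 hw.2) hw'.1,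
    hinner_sub_left (bilin_mem hp hv.1 hw.2) (bilin_mem hp hv.2 hw.1) hw'.2, abs_le]
  constructor <;> linarith [e1.1, e1.2, e2.1, e2.2, e3.1, e3.2]

/-! ### The dissipative term -/

theorem laplacian_mem {p : ℝ} (hp : 0 ≤ p) {v : Coeffs d} (hv : v ∈ HM d (p + 2)) :
    laplacian v ∈ HM d p := by
  have h0 : laplacian v 0 = 0 := by simp [laplacian]
  have hs : Summable fun k => wt p (laplacian v) k ^ 2 := by
    have : wt p (laplacian v) = wt (p + 2) v := by
      funext k
      rw [wt, wt, laplacian, norm_smul, Complex.norm_real, norm_neg,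
        Real.norm_of_nonneg (sq_nonneg _), Real.rpow_add' (latNorm_nonneg k) (by linarith),
        Real.rpow_two]
      ring
    rw [this]
    exact HM.summable hv
  refine HM.mk ⟨fun k r => ?_, growth_of_summable hp h0 hs⟩ (fun k => ?_) h0 hs
  · simp only [laplacian, latNorm_neg, PiLp.smul_apply, smul_eq_mul, map_mul,
      Complex.conj_ofReal, HM.conj hv]
  · rw [laplacian, latDot_smul, HM.latDot_eq hv, mul_zero]

theorem mhdLin_mem {p : ℝ} (hp : 0 ≤ p) (ν η : ℝ) {v : Pair d} (hv : v ∈ HD d (p + 2)) :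
    mhdLin ν η v ∈ HD d p :=
  ⟨(sobolev d p).smul_mem ν (laplacian_mem hp hv.1),
    (sobolev d p).smul_mem η (laplacian_mem hp hv.2)⟩

theorem mhdLin_add (ν η : ℝ) (v w : Pair d) :
    mhdLin ν η (v + w) = mhdLin ν η v + mhdLin ν η w := by
  have h (a b : Coeffs d) : laplacian (a + b) = laplacian a + laplacian b := by
    funext k; simp only [laplacian, Pi.add_apply, smul_add]
  simp only [mhdLin, Prod.fst_add, Prod.snd_add, h, smul_add, Prod.mk_add_mk]

/-- The Poincaré inequality `|k| ≥ 1` for the dissipative term. -/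
theorem hinner_laplacian_le {p ν : ℝ} (hp : 0 ≤ p) (hν : 0 ≤ ν) {v : Coeffs d}
    (hv : v ∈ HM d (p + 1)) : hinner p (ν • laplacian v) v ≤ -ν * hnorm p v ^ 2 := by
  have h0 := HM.map_zero hv
  have hterm (k : Fin d → ℤ) :
      latNorm k ^ (2 * p) * (inner ℂ ((ν • laplacian v) k) (v k)).re
        = -ν * wt (p + 1) v k ^ 2 := by
    have h1 : (ν • laplacian v) k = ((ν * -(latNorm k ^ 2) : ℝ) : ℂ) • v k := by
      ext r; simp [laplacian, mul_assoc]
    have h2 : inner ℂ (v k) (v k) = ((‖v k‖ ^ 2 : ℝ) : ℂ) := by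
      rw [inner_self_eq_norm_sq_to_K]; norm_cast
    rw [h1, inner_smul_left, Complex.conj_ofReal, Complex.re_ofReal_mul, h2, Complex.ofReal_re,
      ← one_wt hp, latNorm_rpow_two_mul]
    ring
  rw [hinner_eq_tsum h0, tsum_congr hterm, tsum_mul_left, ← hinner_self_eq_sq h0, hinner_self h0,
    neg_mul, neg_mul, neg_le_neg_iff]
  refine mul_le_mul_of_nonneg_left (Summable.tsum_le_tsum (fun k => ?_)
    (HM.summable (HM.mono (by linarith) hv)) (HM.summable hv)) hν
  exact pow_le_pow_left₀ (wt_nonneg _ _ _) (wt_mono (by linarith) h0 k) 2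

theorem pinner_mhdLin_le {p ν η : ℝ} (hp : 0 ≤ p) (hν : 0 ≤ ν) (hη : 0 ≤ η) {v : Pair d}
    (hv : v ∈ HD d (p + 1)) : pinner p (mhdLin ν η v) v ≤ -(min ν η) * pnorm p v ^ 2 := by
  have h1 := hinner_laplacian_le hp hν hv.1
  have h2 := hinner_laplacian_le hp hη hv.2
  have h3 := mul_le_mul_of_nonneg_right (min_le_left ν η) (sq_nonneg (hnorm p v.1))
  have h4 := mul_le_mul_of_nonneg_right (min_le_right ν η) (sq_nonneg (hnorm p v.2))
  rw [pnorm_sq (HD_mono (by linarith) hv), pinner]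
  simp only [mhdLin]
  linarith

/-! ### Dini derivatives of norms of curves -/

theorem dini_eq_of_hasDerivWithinAt {f : ℝ → ℝ} {f' t : ℝ}
    (hf : HasDerivWithinAt f f' (Set.Ioi t) t) : dini f t = (f' : EReal) := by
  rw [hasDerivWithinAt_iff_tendsto_slope' (by simp)] at hf
  have hm : Tendsto (fun h : ℝ => t + h) (𝓝[>] 0) (𝓝[>] t) := by
    refine tendsto_nhdsWithin_iff.2 ⟨?_, ?_⟩
    · have : Tendsto (fun h : ℝ => t + h) (𝓝 0) (𝓝 (t + 0)) :=
        (continuous_const.add continuous_id).tendsto 0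
      rw [add_zero] at this
      exact this.mono_left nhdsWithin_le_nhds
    · filter_upwards [self_mem_nhdsWithin] with h hh
      simpa using hh
  have h1 : Tendsto (fun h : ℝ => (((f (t + h) - f t) / h : ℝ) : EReal)) (𝓝[>] 0)
      (𝓝 (f' : EReal)) := by
    refine (continuous_coe_real_ereal.tendsto f').comp ((hf.comp hm).congr fun h => ?_)
    simp only [Function.comp, slope_def_field, add_sub_cancel_left]
  exact h1.limsup_eq

section InnerProductSpace

variable {E : Type*} [NormedAddCommGroup E] [InnerProductSpace ℝ E]

/-- The derivative of the norm of a curve where the curve does not vanish. -/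
theorem hasDerivWithinAt_norm {f : ℝ → E} {f' : E} {s : Set ℝ} {t : ℝ}
    (hf : HasDerivWithinAt f f' s t) (h0 : f t ≠ 0) :
    HasDerivWithinAt (fun x => ‖f x‖) (inner ℝ f' (f t) / ‖f t‖) s t := by
  have hn : 0 < ‖f t‖ := norm_pos_iff.2 h0
  have h := hf.norm_sq.sqrt (pow_pos hn 2).ne'
  simp only [Real.sqrt_sq (norm_nonneg _)] at h
  convert h using 1
  rw [real_inner_comm, mul_div_mul_left _ _ two_ne_zero]

/-- The right derivative of the norm of a curve at a zero of the curve. -/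
theorem hasDerivWithinAt_norm_zero {f : ℝ → E} {f' : E} {t : ℝ}
    (hf : HasDerivWithinAt f f' (Set.Ioi t) t) (h0 : f t = 0) :
    HasDerivWithinAt (fun x => ‖f x‖) ‖f'‖ (Set.Ioi t) t := by
  rw [hasDerivWithinAt_iff_tendsto_slope' (by simp)] at hf ⊢
  refine hf.norm.congr' ?_
  filter_upwards [self_mem_nhdsWithin] with s hs
  have hs' : 0 < s - t := sub_pos.2 hs
  rw [slope_def_module, slope_def_module, h0, sub_zero, norm_zero, sub_zero, norm_smul,
    Real.norm_of_nonneg (inv_nonneg.2 hs'.le), smul_eq_mul]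

end InnerProductSpace

/-! ### Curves of pairs -/

theorem hasDerivWithinAt_emb {τ : EReal} {u : ℝ → Pair d} {z : Pair d} {t : ℝ}
    (hu : ∀ s ∈ timeInterval τ, u s ∈ HDinf d) (ht : t ∈ timeInterval τ)
    (h : HasTimeDeriv τ u z t) (q : ℝ) :
    HasDerivWithinAt (fun s => emb q (u s)) (emb q z) (timeInterval τ) t := by
  rw [hasDerivWithinAt_iff_tendsto_slope, tendsto_iff_norm_sub_tendsto_zero]
  refine (h.2 q).congr' ?_
  filter_upwards [self_mem_nhdsWithin] with s hs
  have h1 := HD_sub (hu s hs.1 q) (hu t ht q)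
  rw [slope_def_module, ← emb_sub (hu s hs.1 q) (hu t ht q), ← emb_smul h1,
    ← emb_sub (HD_smul h1 _) (h.1 q), norm_emb (HD_sub (HD_smul h1 _) (h.1 q))]

theorem timeInterval_mono {σ τ : EReal} (h : σ ≤ τ) : timeInterval σ ⊆ timeInterval τ :=
  fun _ ht => ⟨ht.1, ht.2.trans_le h⟩

theorem timeInterval_mem_nhdsGT {τ : EReal} {t : ℝ} (ht : t ∈ timeInterval τ) :
    timeInterval τ ∈ 𝓝[>] t := by
  have h1 : ∀ᶠ s : ℝ in 𝓝 t, (s : EReal) < τ :=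
    continuous_coe_real_ereal.continuousAt.eventually (gt_mem_nhds ht.2)
  filter_upwards [nhdsWithin_le_nhds h1, self_mem_nhdsWithin] with s hs hs'
  exact ⟨ht.1.trans (le_of_lt hs'), hs⟩

/-- The energy inequality: the time derivative of the error `δ = u - a`, expressed through the
differential error `e` of `a`, is estimated against `δ` itself. -/
theorem pinner_error_le {n p : ℝ} (hn : (d : ℝ) / 2 + 1 < n) (hnp : n ≤ p)
    {K G G' ν η : ℝ} (hK : IsBasicConstant d p p K) (hG : IsKatoConstant d p p G)
    (hG' : IsKatoConstant d p n G') (hν : 0 ≤ ν) (hη : 0 ≤ η) {a δ e : Pair d}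
    (ha : a ∈ HDinf d) (hδ : δ ∈ HDinf d) (he : e ∈ HD d p) {ε D D1 : ℝ}
    (hε : pnorm p e ≤ ε) (hD : pnorm p a ≤ D) (hD1 : pnorm (p + 1) a ≤ D1) :
    pinner p (mhdLin ν η δ + mhdBilin a δ + mhdBilin δ a + mhdBilin δ δ - e) δ
      ≤ (-(min ν η) * pnorm p δ + (G * D + K * D1) * pnorm p δ
        + G' * pnorm n δ * pnorm p δ + ε) * pnorm p δ := by
  have hp : (d : ℝ) / 2 + 1 < p := hn.trans_le hnp
  have hp0 : 0 ≤ p := by have : (0 : ℝ) ≤ d := Nat.cast_nonneg d; linarith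
  have m1 := mhdLin_mem hp0 ν η (hδ (p + 2))
  have m2 := mhdBilin_mem hp (ha p) (hδ (p + 1))
  have m3 := mhdBilin_mem hp (hδ p) (ha (p + 1))
  have m4 := mhdBilin_mem hp (hδ p) (hδ (p + 1))
  rw [pinner_sub_left (HD_add (HD_add (HD_add m1 m2) m3) m4) he (hδ p),
    pinner_add_left (HD_add (HD_add m1 m2) m3) m4 (hδ p),
    pinner_add_left (HD_add m1 m2) m3 (hδ p), pinner_add_left m1 m2 (hδ p)]
  have hX := pnorm_nonneg p δ
  have i1 := pinner_mhdLin_le hp0 hν hη (hδ (p + 1))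
  have i2 := (abs_le.1 (hG.2 a (ha p) δ (hδ (p + 1)))).2
  have i3 := (abs_le.1 (abs_pinner_le m3 (hδ p))).2
  have i4 := (abs_le.1 (hG'.2 δ (hδ p) δ (hδ (p + 1)))).2
  have i5 := (abs_le.1 (abs_pinner_le he (hδ p))).1
  have j2 : G * (pnorm p a * pnorm p δ) * pnorm p δ ≤ G * (D * pnorm p δ) * pnorm p δ := by
    have := hG.1; gcongr
  have j3 : pnorm p (mhdBilin δ a) * pnorm p δ ≤ K * (pnorm p δ * D1) * pnorm p δ := by
    refine mul_le_mul_of_nonneg_right ((hK.2 δ (hδ p) a (ha (p + 1))).trans ?_) hX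
    have := hK.1
    calc _ = K * (pnorm p δ * pnorm (p + 1) a) := by ring
      _ ≤ _ := by gcongr
  have j5 : pnorm p e * pnorm p δ ≤ ε * pnorm p δ := by gcongr
  nlinarith

end MHD

end

theorem mainTheorem2 (d : ℕ) (hd : 2 ≤ d) (n p : ℝ)
    (hn : (d : ℝ) / 2 + 1 < n) (hnp : n ≤ p) :
    -- the bilinear map is well defined between the spaces that enter the constants,
    -- and admissible constants exist
    (∀ v ∈ MHD.HD d p, ∀ w ∈ MHD.HD d (p + 1), MHD.mhdBilin v w ∈ MHD.HD d p) ∧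
    (∃ K : ℝ, MHD.IsBasicConstant d p p K) ∧
    (∃ G : ℝ, MHD.IsKatoConstant d p p G) ∧
    (∃ G : ℝ, MHD.IsKatoConstant d p n G) ∧
    -- the differential inequality
    ∀ Kp Gp Gpn : ℝ, MHD.IsBasicConstant d p p Kp → MHD.IsKatoConstant d p p Gp →
      MHD.IsKatoConstant d p n Gpn →
    ∀ ν η : ℝ, 0 ≤ ν → 0 ≤ η →
    ∀ u₀ ∈ MHD.HDinf d,
    ∀ (T : EReal) (u : ℝ → MHD.Pair d), 0 < T → MHD.IsSolution ν η u₀ T u →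
    ∀ (Ta : EReal) (ua ua' : ℝ → MHD.Pair d), 0 < Ta → MHD.IsC1Curve Ta ua ua' →
      (∀ q : ℝ,
        ContinuousOn (fun t => MHD.pnorm q (u t - ua t)) (MHD.timeInterval (min T Ta)) ∧
        ∀ t ∈ MHD.timeInterval (min T Ta), u t ≠ ua t →
          DifferentiableWithinAt ℝ (fun t => MHD.pnorm q (u t - ua t))
            (MHD.timeInterval (min T Ta)) t) ∧
      ∀ ε Dp Dp1 : ℝ → ℝ,
        MHD.IsEstimator Ta p (MHD.diffError ν η ua ua') ε →
        MHD.IsEstimator Ta p ua Dp →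
        MHD.IsEstimator Ta (p + 1) ua Dp1 →
        ∀ t ∈ MHD.timeInterval (min T Ta),
          MHD.dini (fun t => MHD.pnorm p (u t - ua t)) t ≤
            ((-(min ν η) * MHD.pnorm p (u t - ua t)
              + (Gp * Dp t + Kp * Dp1 t) * MHD.pnorm p (u t - ua t)
              + Gpn * MHD.pnorm n (u t - ua t) * MHD.pnorm p (u t - ua t)
              + ε t : ℝ) : EReal) := by
  have hp : (d : ℝ) / 2 + 1 < p := hn.trans_le hnp
  have hp0 : 0 ≤ p := by have : (0 : ℝ) ≤ d := Nat.cast_nonneg d; linarith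
  refine ⟨fun v hv w hw => MHD.mhdBilin_mem hp hv hw, MHD.exists_basicConstant hp,
    MHD.exists_katoConstant hp le_rfl, MHD.exists_katoConstant hn hnp, ?_⟩
  intro Kp Gp Gpn hKp hGp hGpn ν η hν hη u₀ _ T u _ hu Ta ua ua' _ hua
  obtain ⟨⟨D, hD0, hD⟩, hsol, -⟩ := hu
  set I := MHD.timeInterval (min T Ta) with hI
  have hIT : I ⊆ MHD.timeInterval T := MHD.timeInterval_mono (min_le_left _ _)
  have hITa : I ⊆ MHD.timeInterval Ta := MHD.timeInterval_mono (min_le_right _ _)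
  have hmu : ∀ s ∈ MHD.timeInterval T, u s ∈ MHD.HDinf d := by
    have := (hD 0).1.1
    rwa [hD0] at this
  have hma : ∀ s ∈ MHD.timeInterval Ta, ua s ∈ MHD.HDinf d := hua.1.1
  have hmδ : ∀ s ∈ I, u s - ua s ∈ MHD.HDinf d := fun s hs q =>
    MHD.HD_sub (hmu s (hIT hs) q) (hma s (hITa hs) q)
  set z := fun t => MHD.mhdLin ν η (u t) + MHD.mhdBilin (u t) (u t) with hz
  have hmz : ∀ t ∈ I, z t - ua' t ∈ MHD.HDinf d := fun t ht q =>
    MHD.HD_sub ((hsol t (hIT ht)).1 q) (hua.2.1.1 t (hITa ht) q)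
  -- the curve `u - ua` in the Hilbert space that carries the norm of order `q`
  have hderiv (q : ℝ) (t : ℝ) (ht : t ∈ I) :
      HasDerivWithinAt (fun s => MHD.emb q (u s - ua s)) (MHD.emb q (z t - ua' t)) I t := by
    have h1 := (MHD.hasDerivWithinAt_emb hmu (hIT ht) (hsol t (hIT ht)) q).mono hIT
    have h2 := (MHD.hasDerivWithinAt_emb hma (hITa ht) (hua.2.2 t (hITa ht)) q).mono hITa
    rw [MHD.emb_sub ((hsol t (hIT ht)).1 q) (hua.2.1.1 t (hITa ht) q)]
    exact (h1.sub h2).congr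
      (fun s hs => MHD.emb_sub (hmu s (hIT hs) q) (hma s (hITa hs) q))
      (MHD.emb_sub (hmu t (hIT ht) q) (hma t (hITa ht) q))
  have hnorm (q : ℝ) (s : ℝ) (hs : s ∈ I) :
      MHD.pnorm q (u s - ua s) = ‖MHD.emb q (u s - ua s)‖ :=
    (MHD.norm_emb (hmδ s hs q)).symm
  refine ⟨fun q => ⟨?_, fun t ht hne => ?_⟩, ?_⟩
  · exact ContinuousOn.congr (fun t ht => (hderiv q t ht).continuousWithinAt.norm)
      fun s hs => hnorm q s hs
  · exact ((MHD.hasDerivWithinAt_norm (hderiv q t ht)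
      (MHD.emb_ne_zero (hmδ t ht q) (sub_ne_zero.2 hne))).congr
        (fun s hs => hnorm q s hs) (hnorm q t ht)).differentiableWithinAt
  intro ε Dp Dp1 hε hDp hDp1 t ht
  have hright {g : ℝ → ℝ} {g' : ℝ} (hg : HasDerivWithinAt g g' (Set.Ioi t) t)
      (hgI : ∀ s ∈ I, MHD.pnorm p (u s - ua s) = g s) :
      MHD.dini (fun t => MHD.pnorm p (u t - ua t)) t = (g' : EReal) := by
    refine MHD.dini_eq_of_hasDerivWithinAt (hg.congr_of_eventuallyEq ?_ (hgI t ht))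
    filter_upwards [MHD.timeInterval_mem_nhdsGT ht] with s hs
    exact hgI s hs
  have hδ := (hderiv p t ht).mono_of_mem_nhdsWithin (MHD.timeInterval_mem_nhdsGT ht)
  set δ := u t - ua t with hδdef
  set e := MHD.diffError ν η ua ua' t with he
  have hmut := hmu t (hIT ht)
  have hmat := hma t (hITa ht)
  have hmδt : δ ∈ MHD.HDinf d := hmδ t ht
  have hme : e ∈ MHD.HD d p :=
    MHD.HD_sub (MHD.HD_sub (hua.2.1.1 t (hITa ht) p) (MHD.mhdLin_mem hp0 ν η (hmat (p + 2))))
      (MHD.mhdBilin_mem hp (hmat p) (hmat (p + 1)))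
  -- the evolution equation of the error
  have hevol : z t - ua' t = MHD.mhdLin ν η δ + MHD.mhdBilin (ua t) δ + MHD.mhdBilin δ (ua t)
      + MHD.mhdBilin δ δ - e := by
    have hut : u t = ua t + δ := by rw [hδdef]; abel
    have hlin : MHD.mhdLin ν η (ua t + δ) = MHD.mhdLin ν η (ua t) + MHD.mhdLin ν η δ :=
      MHD.mhdLin_add ν η _ _
    simp only [hz]
    rw [hut, hlin, MHD.mhdBilin_add_left hp (hmat p) (hmδt p)
        (MHD.HD_add (hmat p) (hmδt p)), MHD.mhdBilin_add_right hp (hmat p) (hmat p) (hmδt p),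
      MHD.mhdBilin_add_right hp (hmδt p) (hmat p) (hmδt p), he, MHD.diffError]
    abel
  have hDpt := (hDp.2 t (hITa ht)).2
  have hDp1t := (hDp1.2 t (hITa ht)).2
  have hεt := (hε.2 t (hITa ht)).2
  by_cases h0 : δ = 0
  · have hemb0 : MHD.emb p (0 : MHD.Pair d) = 0 := by
      have := MHD.emb_sub (hmδt p) (hmδt p)
      rwa [sub_self, sub_self] at this
    have hn0 : MHD.pnorm p δ = 0 := by
      rw [← MHD.norm_emb (hmδt p), h0, hemb0, norm_zero]
    have hd := hright (MHD.hasDerivWithinAt_norm_zero hδ (by rw [← hδdef, h0, hemb0]))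
      (hnorm p)
    have hze : z t - ua' t = -e := by
      have hb1 := MHD.mhdBilin_add_right hp (hmat p) (hmδt p) (hmδt p)
      have hb2 := MHD.mhdBilin_add_left hp (hmδt p) (hmδt p) (hmat p)
      have hb3 := MHD.mhdBilin_add_left hp (hmδt p) (hmδt p) (hmδt p)
      have hl := MHD.mhdLin_add ν η δ δ
      rw [h0, add_zero] at hb1 hb2 hb3 hl
      rw [hevol, h0, left_eq_add.1 hb1, left_eq_add.1 hb2, left_eq_add.1 hb3, left_eq_add.1 hl]
      abel
    rw [hd, hn0, EReal.coe_le_coe_iff, MHD.norm_emb (hmz t ht p), hze, MHD.pnorm_neg]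
    linarith
  · have hne : MHD.emb p δ ≠ 0 := MHD.emb_ne_zero (hmδt p) h0
    have hd := hright (MHD.hasDerivWithinAt_norm hδ hne) (hnorm p)
    rw [hd, EReal.coe_le_coe_iff, div_le_iff₀ (norm_pos_iff.2 hne),
      MHD.inner_emb (hmz t ht p) (hmδt p), MHD.norm_emb (hmδt p), hevol]
    exact MHD.pinner_error_le hn hnp hKp hGp hGpn hν hη hmat hmδt hme hεt hDpt hDp1t
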